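/- **Model.** Let $V$ be a set of values and let $\bot\notin V$ be a null-value. The processes $p_1,\dots,p_n$ run deterministic automata that apply the atomic primitives read, write and CAS to a shared memory consisting of value-locations, each holding an element of $V\cup\{\bot\}$ and initially $\bot$, and metadata-locations, holding everything else; $\mathrm{CAS}(l,\mathit{old},\mathit{new})$ replaces the content of $l$ by $\mathit{new}$ and returns true if that content is $\mathit{old}$, and otherwise returns false. A bounded queue of capacity $C$ is a FIFO queue with operations $\mathrm{enq}(x)$, $x\in V$, which adds $x$ and returns true if there are fewer than $C$ elements and otherwise returns false, and $\mathrm{deq}()$, which removes and returns the oldest element, or returns $\bot$ if the queue is empty. An implementation is *linearizable* if in every finite execution all complete operations and some of the incomplete ones (with suitable responses) can be put in a total order that extends their real-time order and obeys this sequential specification. It is *obstruction-free* if, in every reachable state, each process that is executing an operation completes it when it runs alone for sufficiently long. It is *value-independent* if it has the following three properties. 1. *Non-creative*: whenever an operation uses a value $v\in V$ as an argument of a write or a CAS, or returns it, the same operation has earlier read $v$ in a value-location or received it as its argument. 2. *Enqueue-value-independent*: let $S$ be a reachable state, $p$ a process that is idle in $S$, and $a_1,\dots,a_k,v$ distinct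 values that appear in no value-location in $S$. If $p$, running alone from $S$, executes $\mathrm{enq}(a_1),\dots,\mathrm{enq}(a_k)$, respectively the same sequence with $\mathrm{enq}(v)$ instead of $\mathrm{enq}(a_i)$, then the resulting memory states are identical, except that every value-location storing $a_i$ after the first run stores $v$ after the second. 3. *Dequeue-value-independent*: let $S$ be a reachable state, $p$ a process that is idle in $S$, and $x$ a value that is stored in exactly one value-location in $S$. Suppose that $p$, running alone from $S$ and executing $\mathrm{deq}()$ until the queue is empty, obtains $x$ from exactly one of its dequeues. Then, for every $y\in V$, if $x$ is replaced by $y$ in the memory of $S$ and $p$ executes the same successful dequeues again, they return the same values as before, except that $y$ is returned in place of $x$. **Theorem.** There are absolute constants $K,n_0\in\mathbb N$ and $c>0$ such that the following holds for all $n\ge 1$ and $C$ with $n<C/2$ and for every set $V$ with at least $K\cdot n\cdot C$ elements. Every obstruction-free, linearizable, value-independent implementation of a bounded queue of capacity $C$ with values in $V$, for $n$ processes using read, write and CAS, has at least $$C+\left\lfloor\frac{n-32}{40}\right\rfloor$$ value-locations. In particular it uses $C+\Omega(n)$ value-locations: at least $C+c\,n$ of them if $n\ge n_0$. -/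

import Mathlib

namespace BQueue

/-! ### The sequential bounded queue -/

/-- Operations of a bounded queue of elements of type `V`. -/
inductive Op (V : Type*) where
  | enq (x : V)
  | deq

/-- Responses: `enqR b` for an enqueue, `deqR w` for a dequeue, where `w = none` is `⊥`. -/
inductive Resp (V : Type*) where
  | enqR (b : Bool)
  | deqR (w : Option V)

/-- The sequential bounded queue of capacity `C`. The state lists the elements, oldest first. -/
def seqStep {V : Type*} (C : ℕ) : List V → Op V → List V × Resp V
  | q, .enq x => if q.length < C then (q ++ [x], .enqR true) else (q, .enqR false)
  | [], .deq => ([], .deqR none)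
  | x :: q, .deq => (q, .deqR (some x))

/-- `Legal C q s`: started in state `q`, the sequential bounded queue of capacity `C` answers the
operations of `s` by the responses recorded in `s`. -/
def Legal {V : Type*} (C : ℕ) : List V → List (Op V × Resp V) → Prop
  | _, [] => True
  | q, (o, r) :: s => (seqStep C q o).2 = r ∧ Legal C (seqStep C q o).1 s

/-! ### Shared memory, implementations and executions -/

/-- Primitives on the shared memory. A value-location (in `VL`) stores an element of `V` or
`⊥ = none`; a metadata-location (in `ML`) stores an element of `M`. -/
inductive Prim (V VL ML M : Type*) where
  | readV (l : VL)
  | writeV (l : VL) (w : Option V)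
  | casV (l : VL) (old new : Option V)
  | readM (l : ML)
  | writeM (l : ML) (m : M)
  | casM (l : ML) (old new : M)

/-- Responses of primitives. -/
inductive PrimResp (V M : Type*) where
  | value (w : Option V)
  | metadata (m : M)
  | ack
  | bool (b : Bool)

/-- What a process does next inside an operation: apply a primitive, or return a response. -/
inductive Action (V VL ML M : Type*) where
  | prim (a : Prim V VL ML M)
  | ret (r : Resp V)

/-- A deterministic implementation for `n` processes, with local states in `L`. The local state
may survive from one operation to the next. -/
structure Implementation (n : ℕ) (V VL ML M L : Type*) where
  /-- initial local states -/
  initLocal : Fin n → L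
  /-- initial contents of the metadata-locations -/
  initMeta : ML → M
  /-- local state after the invocation of an operation -/
  invoke : Fin n → Op V → L → L
  /-- next action inside an operation -/
  act : Fin n → L → Action V VL ML M
  /-- local state after the response of a primitive -/
  next : Fin n → L → PrimResp V M → L

/-- A configuration: contents of the shared memory, local states, and which processes are
executing an operation. -/
structure Config (n : ℕ) (V VL ML M L : Type*) where
  vmem : VL → Option V
  mmem : ML → M
  loc : Fin n → L
  busy : Fin n → Bool

/-- Events: invocations, primitives with their responses, and responses of operations. -/
inductive Event (n : ℕ) (V VL ML M : Type*) where
  | inv (p : Fin n) (o : Op V)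
  | prim (p : Fin n) (a : Prim V VL ML M) (r : PrimResp V M)
  | res (p : Fin n) (r : Resp V)

section
variable {n : ℕ} {V VL ML M L : Type*}

open Classical in
/-- The response of a primitive. -/
noncomputable def primResp (vm : VL → Option V) (mm : ML → M) : Prim V VL ML M → PrimResp V M
  | .readV l => .value (vm l)
  | .writeV _ _ => .ack
  | .casV l old _ => .bool (decide (vm l = old))
  | .readM l => .metadata (mm l)
  | .writeM _ _ => .ack
  | .casM l old _ => .bool (decide (mm l = old))

open Classical in
/-- The contents of the value-locations after a primitive. -/
noncomputable def primV (vm : VL → Option V) : Prim V VL ML M → VL → Option V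
  | .writeV l w => Function.update vm l w
  | .casV l old new => if vm l = old then Function.update vm l new else vm
  | _ => vm

open Classical in
/-- The contents of the metadata-locations after a primitive. -/
noncomputable def primM (mm : ML → M) : Prim V VL ML M → ML → M
  | .writeM l m => Function.update mm l m
  | .casM l old new => if mm l = old then Function.update mm l new else mm
  | _ => mm

/-- The initial configuration: all value-locations contain `⊥` and all processes are idle. -/
def Implementation.init (A : Implementation n V VL ML M L) : Config n V VL ML M L where
  vmem := fun _ => none
  mmem := A.initMeta
  loc := A.initLocal
  busy := fun _ => false

/-- One event. Only an idle process invokes an operation (executions are well-formed). -/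
inductive Step (A : Implementation n V VL ML M L) :
    Config n V VL ML M L → Event n V VL ML M → Config n V VL ML M L → Prop
  | inv (c : Config n V VL ML M L) (p : Fin n) (o : Op V) (h : c.busy p = false) :
      Step A c (.inv p o)
        { c with
          loc := Function.update c.loc p (A.invoke p o (c.loc p))
          busy := Function.update c.busy p true }
  | prim (c : Config n V VL ML M L) (p : Fin n) (a : Prim V VL ML M) (h : c.busy p = true)
      (ha : A.act p (c.loc p) = .prim a) :
      Step A c (.prim p a (primResp c.vmem c.mmem a))
        { c with
          vmem := primV c.vmem a
          mmem := primM c.mmem a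
          loc := Function.update c.loc p (A.next p (c.loc p) (primResp c.vmem c.mmem a)) }
  | res (c : Config n V VL ML M L) (p : Fin n) (r : Resp V) (h : c.busy p = true)
      (hr : A.act p (c.loc p) = .ret r) :
      Step A c (.res p r) { c with busy := Function.update c.busy p false }

/-- `Exec A c τ c'`: the finite sequence of events `τ` leads from `c` to `c'`. -/
inductive Exec (A : Implementation n V VL ML M L) :
    Config n V VL ML M L → List (Event n V VL ML M) → Config n V VL ML M L → Prop
  | nil (c : Config n V VL ML M L) : Exec A c [] c
  | cons {c c' c'' : Config n V VL ML M L} {e : Event n V VL ML M}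
      {τ : List (Event n V VL ML M)} :
      Step A c e c' → Exec A c' τ c'' → Exec A c (e :: τ) c''

/-- Configurations reached by executions. -/
def Reachable (A : Implementation n V VL ML M L) (c : Config n V VL ML M L) : Prop :=
  ∃ τ, Exec A A.init τ c

/-- `e` is a primitive applied by `p`. -/
def IsPrimOf (p : Fin n) (e : Event n V VL ML M) : Prop := ∃ a r, e = .prim p a r

/-- `SeqRun A p c s c'`: from `c`, where `p` is idle, process `p` alone executes one after the
other the operations listed in `s`, obtains the responses listed there, and ends up in `c'`. -/
inductive SeqRun (A : Implementation n V VL ML M L) (p : Fin n) :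
    Config n V VL ML M L → List (Op V × Resp V) → Config n V VL ML M L → Prop
  | nil (c : Config n V VL ML M L) (h : c.busy p = false) : SeqRun A p c [] c
  | cons {c c' c'' : Config n V VL ML M L} {o : Op V} {r : Resp V}
      {τ : List (Event n V VL ML M)} {s : List (Op V × Resp V)} :
      (∀ e ∈ τ, IsPrimOf p e) → Exec A c (.inv p o :: (τ ++ [.res p r])) c' →
      SeqRun A p c' s c'' → SeqRun A p c ((o, r) :: s) c''

/-! ### Obstruction-freedom and linearizability -/

/-- Whenever a process executes an operation, it completes it if it runs long enough alone. -/
def ObstructionFree (A : Implementation n V VL ML M L) : Prop :=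
  ∀ c, Reachable A c → ∀ p, c.busy p = true →
    ∃ τ r c', (∀ e ∈ τ, IsPrimOf p e) ∧ Exec A c (τ ++ [.res p r]) c'

/-- In `τ`, the operation `o` invoked by event number `i` completes with event number `j`, with
response `r`. -/
def CompletesAt (τ : List (Event n V VL ML M)) (i j : ℕ) (o : Op V) (r : Resp V) : Prop :=
  ∃ p, τ[i]? = some (.inv p o) ∧ τ[j]? = some (.res p r) ∧ i < j ∧
    ∀ k r', i < k → k < j → τ[k]? ≠ some (.res p r')

/-- In `τ`, the operation invoked by event `i` responds before event `i'`. -/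
def Precedes (τ : List (Event n V VL ML M)) (i i' : ℕ) : Prop :=
  ∃ j o r, CompletesAt τ i j o r ∧ j < i'

/-- `τ` has a linearization `S` with respect to the bounded queue of capacity `C`. An operation of
`τ` is named by the position of its invocation; an entry `(i, o, r)` of `S` is the operation `o`
invoked at position `i`, with response `r`. All complete operations and some incomplete ones occur
in `S`, each at most once. -/
def LinearizableTrace (C : ℕ) (τ : List (Event n V VL ML M)) : Prop :=
  ∃ S : List (ℕ × Op V × Resp V),
    (S.map Prod.fst).Nodup ∧
    (∀ s ∈ S, ∃ p, τ[s.1]? = some (.inv p s.2.1)) ∧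
    (∀ i j o r, CompletesAt τ i j o r → (i, o, r) ∈ S) ∧
    S.Pairwise (fun s t => ¬ Precedes τ t.1 s.1) ∧
    Legal C [] (S.map Prod.snd)

/-- Every finite execution is linearizable. -/
def Linearizable (C : ℕ) (A : Implementation n V VL ML M L) : Prop :=
  ∀ τ c, Exec A A.init τ c → LinearizableTrace C τ

/-! ### Value-independence -/

/-- `Uses p v e`: in event `e`, process `p` uses the value `v` as an argument of a write or a CAS,
or returns it. -/
def Uses (p : Fin n) (v : V) (e : Event n V VL ML M) : Prop :=
  (∃ l r, e = .prim p (.writeV l (some v)) r) ∨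
  (∃ l w r, e = .prim p (.casV l (some v) w) r) ∨
  (∃ l w r, e = .prim p (.casV l w (some v)) r) ∨
  e = .res p (.deqR (some v))

/-- `Learns p v e`: in event `e`, process `p` reads `v` in a value-location or receives it as the
argument of an enqueue. -/
def Learns (p : Fin n) (v : V) (e : Event n V VL ML M) : Prop :=
  (∃ l, e = .prim p (.readV l) (.value (some v))) ∨ e = .inv p (.enq v)

/-- An operation uses only values that it has learnt itself, that is, earlier and with no response
of the same process in between. The null-value `⊥` is not a value. -/
def NonCreative (A : Implementation n V VL ML M L) : Prop :=
  ∀ τ e c, Exec A A.init (τ ++ [e]) c → ∀ p v, Uses p v e →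
    ∃ τ₁ e' τ₂, τ = τ₁ ++ e' :: τ₂ ∧ Learns p v e' ∧ ∀ r, Event.res p r ∉ τ₂

open Classical in
/-- Replace the value `x` by `y` wherever the value-locations store it. -/
noncomputable def substV (x y : V) (vm : VL → Option V) : VL → Option V :=
  fun l => if vm l = some x then some y else vm l

/-- Two runs of enqueues `a₁, …, aₖ` and `a₁, …, v, …, aₖ` (with `v` for `aᵢ`) by an idle process
from the same reachable state lead to the same memory, up to `v` in place of `aᵢ`. -/
def EnqueueValueIndependent (A : Implementation n V VL ML M L) : Prop :=
  ∀ (c c₁ c₂ : Config n V VL ML M L) (p : Fin n) (k : ℕ) (a : Fin k → V) (i : Fin k) (v : V)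
    (r₁ r₂ : Fin k → Resp V),
    Reachable A c → Function.Injective a → (∀ j, a j ≠ v) →
    (∀ l, c.vmem l ≠ some v) → (∀ l j, c.vmem l ≠ some (a j)) →
    SeqRun A p c (List.ofFn fun j => (Op.enq (a j), r₁ j)) c₁ →
    SeqRun A p c (List.ofFn fun j => (Op.enq (Function.update a i v j), r₂ j)) c₂ →
    c₂.vmem = substV (a i) v c₁.vmem ∧ c₂.mmem = c₁.mmem

open Classical in
/-- If `x` is stored in exactly one value-location of a reachable state, and an idle process that
dequeues until the queue is empty obtains `vs`, with `x` exactly once, then after `x` is replaced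
by `y` in memory the same dequeues return `vs` with `y` in place of `x`. -/
def DequeueValueIndependent (A : Implementation n V VL ML M L) : Prop :=
  ∀ (c c₁ : Config n V VL ML M L) (p : Fin n) (x y : V) (vs : List V),
    Reachable A c → (∃! l, c.vmem l = some x) →
    SeqRun A p c (vs.map (fun w => (Op.deq, Resp.deqR (some w))) ++ [(Op.deq, Resp.deqR none)]) c₁ →
    vs.count x = 1 →
    ∃ c₂, SeqRun A p { c with vmem := substV x y c.vmem }
      (vs.map fun w => (Op.deq, Resp.deqR (some (if w = x then y else w)))) c₂

/-- Value-independence. -/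
def ValueIndependent (A : Implementation n V VL ML M L) : Prop :=
  NonCreative A ∧ EnqueueValueIndependent A ∧ DequeueValueIndependent A

end

end BQueue

/-! Let m be the number of value-locations and suppose m ≤ C + s with 10s + 7 ≤ n. The proof is a
covering argument: processes are stopped just before they overwrite a location, and some of them are
later released to destroy an element of a full queue.

A process that alone fills the queue, empties it and refills it with other values overwrites at
least 2C - m locations that held a value (`exists_stops`). Stopping one process after another yields
many covered locations. An overwriting may pass through ⊥, and then two processes are needed, one
for a → ⊥ and one for ⊥ → w. Hence `Covered` has two sets: at l ∈ D the poised processes can turn α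
l into ω l, while at l ∈ U only the second half is available. The first half is supplied by
pigeonhole as long as |U| > 2(m - C) (`Covered.complete`).

In `Covered.false` an idle process p fills the queue with fresh values e. By counting, some l ∈ D is
the only location that stores a certain inner value e j, while α l was in no location before the
filling. By enqueue-value-independence p may enqueue α l instead of e j, and then l alone stores α
l. The poised processes turn it into ω l, and by dequeue-value-independence p now dequeues ω l in
its place (`not_killer`). No linearization allows this (`legal_clash`): since the first element
still comes out, the queue consists of exactly the C values that p has enqueued; ω l is none of
them, and a pending enqueue could only put it behind the last one, which p dequeues later.

Pending operations could also disturb the solo runs of p themselves. Each disturbance uses up one of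
them, so p eventually meets a sequential queue (`exists_stable`). -/

namespace BQueue

/-! ### The sequential queue, and legal sequences with foreign operations interspersed -/

section Sequential
variable {V : Type*} {C : ℕ}

/-- The state of the sequential queue after the operations of `s`. -/
def final (C : ℕ) (q : List V) (s : List (Op V × Resp V)) : List V :=
  s.foldl (fun q x => (seqStep C q x.1).1) q

theorem legal_append (q : List V) (s t : List (Op V × Resp V)) :
    Legal C q (s ++ t) ↔ Legal C q s ∧ Legal C (final C q s) t := by
  induction s generalizing q with
  | nil => simp [Legal, final]
  | cons x s ih =>
    obtain ⟨o, r⟩ := x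
    simp only [List.cons_append, Legal, ih, and_assoc]
    rfl

/-- The values enqueued successfully. -/
def enqs (s : List (Op V × Resp V)) : List V :=
  s.filterMap fun x => match x with
    | (.enq v, .enqR true) => some v
    | _ => none

/-- The values dequeued. -/
def deqs (s : List (Op V × Resp V)) : List V :=
  s.filterMap fun x => match x with
    | (.deq, .deqR (some v)) => some v
    | _ => none

/-- Both sides list everything that was ever in the queue in order of insertion: on the right, what
has left, followed by what remains. -/
theorem fifo {q : List V} {s : List (Op V × Resp V)} (h : Legal C q s) :
    q ++ enqs s = deqs s ++ final C q s := by
  induction s generalizing q with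
  | nil => simp [enqs, deqs, final]
  | cons x s ih =>
    obtain ⟨o, r⟩ := x
    obtain ⟨rfl, h2⟩ := h
    have := ih h2
    cases o with
    | enq v =>
      by_cases hq : q.length < C
      · have hs : seqStep C q (.enq v) = (q ++ [v], .enqR true) := by simp [seqStep, hq]
        rw [hs] at this
        simpa [enqs, deqs, final, hs] using this
      · have hs : seqStep C q (.enq v) = (q, .enqR false) := by simp [seqStep, hq]
        rw [hs] at this
        simpa [enqs, deqs, final, hs] using this
    | deq => cases q <;> simp_all [seqStep, enqs, deqs, final]

theorem final_length {q : List V} (hq : q.length ≤ C) (s : List (Op V × Resp V)) :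
    (final C q s).length ≤ C := by
  induction s generalizing q with
  | nil => exact hq
  | cons x s ih =>
    obtain ⟨o, r⟩ := x
    refine ih (q := (seqStep C q o).1) ?_
    cases o with
    | enq v =>
      by_cases h : q.length < C
      · simp [seqStep, h]
      · simp [seqStep, h, hq]
    | deq =>
      cases q with
      | nil => exact hq
      | cons y q => exact (Nat.le_succ _).trans hq

theorem eq_nil_of_seqStep_deq {q : List V} (h : (seqStep C q .deq).2 = .deqR none) : q = [] := by
  cases q <;> simp_all [seqStep]

theorem enqs_map_enq (e : List V) : enqs (e.map fun v => (Op.enq v, Resp.enqR true)) = e := by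
  simp [enqs, List.filterMap_map]

theorem deqs_map_deq (e : List V) :
    deqs (e.map fun v => (Op.deq, Resp.deqR (some v))) = e := by
  simp [deqs, List.filterMap_map]

theorem enqs_map_deq (e : List V) :
    enqs (e.map fun v => (Op.deq, Resp.deqR (some v))) = [] := by
  simp [enqs]

section Flagged
variable {ι : Type*}

/-- The entries with the mark `none`. -/
def own (u : List (Option ι × Op V × Resp V)) : List (Op V × Resp V) :=
  (u.filter fun t => t.1.isNone).map Prod.snd

theorem own_eq_append {u : List (Option ι × Op V × Resp V)} {a b : List (Op V × Resp V)}
    (h : own u = a ++ b) : ∃ u₁ u₂, u = u₁ ++ u₂ ∧ own u₁ = a ∧ own u₂ = b := by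
  simp only [own, List.map_eq_append_iff, List.filter_eq_append_iff] at h
  obtain ⟨_, _, ⟨u₁, u₂, rfl, rfl, rfl⟩, h1, h2⟩ := h
  exact ⟨u₁, u₂, rfl, h1, h2⟩

theorem own_eq_cons {u : List (Option ι × Op V × Resp V)} {a : Op V × Resp V}
    {b : List (Op V × Resp V)} (h : own u = a :: b) :
    ∃ u₁ u₂, u = u₁ ++ (none, a) :: u₂ ∧ own u₁ = [] ∧ own u₂ = b := by
  simp only [own, List.map_eq_cons_iff, List.filter_eq_cons_iff] at h
  obtain ⟨⟨x, y⟩, _, ⟨u₁, u₂, rfl, h0, hx, rfl⟩, h1, h2⟩ := h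
  simp at hx h1
  subst hx h1
  refine ⟨u₁, u₂, rfl, ?_, h2⟩
  simpa [own] using h0

theorem own_sublist (u : List (Option ι × Op V × Resp V)) :
    (own u).Sublist (u.map Prod.snd) := List.filter_sublist.map _

theorem count_enqs [DecidableEq V] {u : List (Option ι × Op V × Resp V)} {x : V}
    (h : ∀ i r, (some i, Op.enq x, r) ∉ u) :
    (enqs (u.map Prod.snd)).count x = (enqs (own u)).count x := by
  induction u with
  | nil => rfl
  | cons t u ih =>
    have ih := ih fun i r hm => h i r (List.mem_cons_of_mem _ hm)
    obtain ⟨_ | i, o, r⟩ := t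
    · rw [show own ((none, o, r) :: u) = (o, r) :: own u by simp [own]]
      simp only [enqs, List.map_cons, List.filterMap_cons] at ih ⊢
      split <;> simp_all [List.count_cons]
    · rw [show own ((some i, o, r) :: u) = own u by simp [own], ← ih]
      simp only [enqs, List.map_cons, List.filterMap_cons]
      split
      · rfl
      · rename_i v hv
        split at hv
        · rename_i v' heq
          simp only [Prod.mk.injEq] at heq
          simp only [Option.some.injEq] at hv
          subst hv
          rw [List.count_cons_of_ne]
          rintro rfl
          exact h i r (by simp [heq.1])
        · simp at hv

/-- After a full queue `e` has been built up and `e.head` is still to come out, nothing but `e`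
is in the queue, whatever marked operations interfere. -/
theorem legal_clash {u : List (Option ι × Op V × Resp V)} {e f : List V} {x z w : V}
    (hu : Legal C [] (u.map Prod.snd))
    (hown : own u = (e.map fun v => (Op.enq v, Resp.enqR true)) ++
      f.map fun v => (Op.deq, Resp.deqR (some v)))
    (hC : e.length = C) (he : e.Nodup) (hx : e.head? = some x) (hxf : x ∈ f)
    (hz : [w, z].Sublist f) (hw : w ∉ e) (hux : ∀ i r, (some i, Op.enq x, r) ∉ u)
    (huz : ∀ i r, (some i, Op.enq z, r) ∉ u) : False := by
  classical
  obtain ⟨u₁, u₂, rfl, h1, h2⟩ := own_eq_append hown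
  rw [List.map_append, legal_append] at hu
  obtain ⟨l1, l2⟩ := hu
  have f1 := fifo l1
  have f2 := fifo l2
  have hlen : (final C [] (u₁.map Prod.snd)).length ≤ C := final_length (by simp) _
  set q := final C [] (u₁.map Prod.snd)
  have c1 : (enqs (u₁.map Prod.snd)).count x = 1 := by
    rw [count_enqs fun i r hm => hux i r (List.mem_append_left _ hm), h1, enqs_map_enq]
    refine List.count_eq_one_of_mem he (List.mem_of_mem_head? hx)
  have c2 : (enqs (u₂.map Prod.snd)).count x = 0 := by
    rw [count_enqs fun i r hm => hux i r (List.mem_append_right _ hm), h2, enqs_map_deq]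
    rfl
  have c3 : (enqs (u₂.map Prod.snd)).count z = 0 := by
    rw [count_enqs fun i r hm => huz i r (List.mem_append_right _ hm), h2, enqs_map_deq]
    rfl
  have s1 : e.Sublist (enqs (u₁.map Prod.snd)) := by
    rw [← enqs_map_enq e, ← h1]
    exact (own_sublist u₁).filterMap _
  have s2 : f.Sublist (deqs (u₂.map Prod.snd)) := by
    rw [← deqs_map_deq f, ← h2]
    exact (own_sublist u₂).filterMap _
  -- `x` is dequeued in the second half and enqueued only in the first.
  have xq : x ∈ q := by
    have : x ∈ q ++ enqs (u₂.map Prod.snd) := by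
      rw [f2]; exact List.mem_append_left _ (s2.subset hxf)
    rcases List.mem_append.1 this with h | h
    · exact h
    · exact absurd h (List.count_eq_zero.1 c2)
  have hxd : x ∉ deqs (u₁.map Prod.snd) := by
    have := congrArg (List.count x) f1
    rw [List.nil_append, List.count_append, c1] at this
    have h3 := List.count_pos_iff.2 xq
    exact List.count_eq_zero.1 (by omega)
  -- By FIFO order nothing of `e` can leave before its head `x`; so all of `e` is still there, and
  -- the capacity leaves no room for more.
  have hq : e = q := by
    rw [List.nil_append] at f1
    rw [f1] at s1
    obtain ⟨e₁, e₂, rfl, g1, g2⟩ := List.sublist_append_iff.1 s1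
    cases e₁ with
    | nil => exact g2.eq_of_length_le (by simp at hC ⊢; omega)
    | cons y e₁ =>
      simp at hx
      subst hx
      exact absurd (g1.subset (by simp)) hxd
  -- `w` is not in `q`, so it was enqueued later, and then so was the `z` behind it; but nobody
  -- enqueues `z` in the second half.
  have s3 : [w, z].Sublist (q ++ enqs (u₂.map Prod.snd)) := by
    rw [f2]
    exact (hz.trans s2).trans (List.sublist_append_left _ _)
  obtain ⟨e₁, e₂, h3, g1, g2⟩ := List.sublist_append_iff.1 s3
  rcases e₁ with _ | ⟨y, e₁⟩
  · simp at h3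
    subst h3
    exact List.count_eq_zero.1 c3 (g2.subset (by simp))
  · simp at h3
    obtain ⟨rfl, h3⟩ := h3
    exact hw (hq ▸ g1.subset (by simp))

/-- Every segment that ends with an empty queue, but is not legal on its own, contains a marked
operation. -/
theorem length_le_of_segments {u : List (Option ι × Op V × Resp V)}
    {ws : List (List (Op V × Resp V))} (hu : Legal C [] (u.map Prod.snd))
    (hown : own u = (ws.map fun w => w ++ [(Op.deq, Resp.deqR none)]).flatten)
    (hws : ∀ w ∈ ws, ¬ Legal C [] w) : ws.length ≤ (u.filterMap Prod.fst).length := by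
  induction ws generalizing u with
  | nil => simp
  | cons w ws ih =>
    simp only [List.map_cons, List.flatten_cons, List.append_assoc] at hown
    obtain ⟨u₁, u₂, rfl, h1, h2⟩ := own_eq_append hown
    obtain ⟨u₃, u₄, rfl, h3, h4⟩ := own_eq_cons h2
    simp only [List.map_append, List.map_cons, legal_append] at hu
    obtain ⟨l1, l2, l3, l4⟩ := hu
    -- The unsuccessful dequeue resets the state to the empty queue, so that the induction can
    -- restart.
    have hnil := eq_nil_of_seqStep_deq l3
    rw [hnil] at l4
    have := ih (u := u₄) l4 h4 fun w hw => hws w (List.mem_cons_of_mem _ hw)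
    have h5 : (u₁.filterMap Prod.fst).length ≠ 0 := by
      intro h5
      refine hws w (by simp) ?_
      rw [← h1, own, List.filter_eq_self.2]
      · exact l1
      · rintro ⟨_ | i, t⟩ ht
        · rfl
        · rw [List.length_eq_zero_iff, List.filterMap_eq_nil_iff] at h5
          simpa using h5 _ ht
    simp only [List.filterMap_append, List.length_append, List.filterMap_cons, List.length_cons]
    omega

end Flagged

theorem length_deqs_le {s : List (Op V × Resp V)} (h : Legal C [] s) :
    (deqs s).length ≤ (enqs s).length := by
  have := congrArg List.length (fifo h)
  simp only [List.nil_append, List.length_append] at this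
  omega

end Sequential

/-! ### Executions, solo runs, absent values and pending operations -/

section Executions
variable {n : ℕ} {V VL ML M L : Type*} {A : Implementation n V VL ML M L} {p : Fin n}

theorem Exec.append {c c' c'' : Config n V VL ML M L} {σ τ : List (Event n V VL ML M)}
    (h : Exec A c σ c') (h' : Exec A c' τ c'') : Exec A c (σ ++ τ) c'' := by
  induction h with
  | nil => exact h'
  | cons s _ ih => exact .cons s (ih h')

theorem Exec.split {c c'' : Config n V VL ML M L} {σ τ : List (Event n V VL ML M)}
    (h : Exec A c (σ ++ τ) c'') : ∃ c', Exec A c σ c' ∧ Exec A c' τ c'' := by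
  induction σ generalizing c with
  | nil => exact ⟨c, .nil c, h⟩
  | cons e σ ih =>
    cases h with
    | cons s h =>
      obtain ⟨c', h1, h2⟩ := ih h
      exact ⟨c', .cons s h1, h2⟩

theorem Exec.single {c c' : Config n V VL ML M L} {e : Event n V VL ML M} (h : Step A c e c') :
    Exec A c [e] c' := .cons h (.nil _)

theorem Reachable.exec {c c' : Config n V VL ML M L} {σ : List (Event n V VL ML M)}
    (h : Reachable A c) (h' : Exec A c σ c') : Reachable A c' := by
  obtain ⟨τ, h⟩ := h
  exact ⟨τ ++ σ, h.append h'⟩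

/-- `e` is an event of process `p`. -/
def EventOf (p : Fin n) : Event n V VL ML M → Prop
  | .inv q _ => q = p
  | .prim q _ _ => q = p
  | .res q _ => q = p

theorem IsPrimOf.eventOf {e : Event n V VL ML M} (h : IsPrimOf p e) : EventOf p e := by
  obtain ⟨a, r, rfl⟩ := h
  rfl

/-- Apart from `p`, the processes are in the same local states in `c` and in `d`. -/
def Frame (p : Fin n) (c d : Config n V VL ML M L) : Prop :=
  ∀ q, q ≠ p → d.loc q = c.loc q ∧ d.busy q = c.busy q

theorem Frame.refl (c : Config n V VL ML M L) : Frame p c c := fun _ _ => ⟨rfl, rfl⟩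

theorem Frame.trans {c d e : Config n V VL ML M L} (h : Frame p c d) (h' : Frame p d e) :
    Frame p c e := fun q hq => ⟨(h' q hq).1.trans (h q hq).1, (h' q hq).2.trans (h q hq).2⟩

theorem Step.frame {c c' : Config n V VL ML M L} {e : Event n V VL ML M} (h : Step A c e c')
    (he : EventOf p e) : Frame p c c' := by
  intro q hq
  cases h <;> simp only [EventOf] at he <;> subst he <;> simp [Function.update_of_ne hq]

theorem Exec.frame {c c' : Config n V VL ML M L} {σ : List (Event n V VL ML M)}
    (h : Exec A c σ c') (hσ : ∀ e ∈ σ, EventOf p e) : Frame p c c' := by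
  induction h with
  | nil => exact .refl _
  | cons s _ ih =>
    exact (s.frame (hσ _ (by simp))).trans (ih fun e he => hσ e (List.mem_cons_of_mem _ he))

theorem Exec.busy_of_no_res {c c' : Config n V VL ML M L} {σ : List (Event n V VL ML M)}
    (h : Exec A c σ c') (hb : c.busy p = true) (hσ : ∀ r, Event.res p r ∉ σ) :
    c'.busy p = true := by
  induction h with
  | nil => exact hb
  | cons s _ ih =>
    refine ih ?_ fun r hr => hσ r (List.mem_cons_of_mem _ hr)
    cases s with
    | inv q => by_cases h : p = q <;> simp_all [Function.update]
    | prim => exact hb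
    | res q r =>
      have : p ≠ q := by rintro rfl; exact hσ r (by simp)
      simp [Function.update_of_ne this, hb]

/-! ### Solo runs -/

/-- The trace consists of complete operations of `p`, as listed, and of primitives. -/
inductive Blocks (p : Fin n) : List (Event n V VL ML M) → List (Op V × Resp V) → Prop
  | nil : Blocks p [] []
  | prim {q : Fin n} {a : Prim V VL ML M} {r : PrimResp V M} {σ : List (Event n V VL ML M)}
      {s : List (Op V × Resp V)} : Blocks p σ s → Blocks p (.prim q a r :: σ) s
  | op {o : Op V} {r : Resp V} {π σ : List (Event n V VL ML M)} {s : List (Op V × Resp V)} :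
      (∀ e ∈ π, ∃ q, IsPrimOf q e) → Blocks p σ s →
      Blocks p (.inv p o :: (π ++ .res p r :: σ)) ((o, r) :: s)

theorem Blocks.append {σ τ : List (Event n V VL ML M)} {s t : List (Op V × Resp V)}
    (h : Blocks p σ s) (h' : Blocks p τ t) : Blocks p (σ ++ τ) (s ++ t) := by
  induction h with
  | nil => exact h'
  | prim _ ih => exact .prim ih
  | op hπ _ ih => simpa using Blocks.op hπ ih

theorem Blocks.of_prims {σ : List (Event n V VL ML M)} (h : ∀ e ∈ σ, ∃ q, IsPrimOf q e) :
    Blocks p σ [] := by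
  induction σ with
  | nil => exact .nil
  | cons e σ ih =>
    obtain ⟨q, a, r, rfl⟩ := h e (by simp)
    exact .prim (ih fun e he => h e (List.mem_cons_of_mem _ he))

theorem Blocks.inv_mem {σ : List (Event n V VL ML M)} {s : List (Op V × Resp V)}
    (h : Blocks p σ s) {q : Fin n} {o : Op V} (ho : Event.inv q o ∈ σ) :
    q = p ∧ ∃ r, (o, r) ∈ s := by
  induction h with
  | nil => simp at ho
  | prim _ ih => exact ih (by simpa using ho)
  | op hπ _ ih =>
    rcases List.mem_cons.1 ho with h | h
    · simp only [Event.inv.injEq] at h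
      obtain ⟨rfl, rfl⟩ := h
      exact ⟨rfl, _, List.mem_cons_self⟩
    · rcases List.mem_append.1 h with h | h
      · obtain ⟨q', a, r, h⟩ := hπ _ h
        cases h
      · obtain ⟨h1, r, h2⟩ := ih (by simpa using h)
        exact ⟨h1, r, List.mem_cons_of_mem _ h2⟩

theorem Blocks.res_mem {σ : List (Event n V VL ML M)} {s : List (Op V × Resp V)}
    (h : Blocks p σ s) {o : Op V} {r : Resp V} (ho : (o, r) ∈ s) : Event.res p r ∈ σ := by
  induction h with
  | nil => simp at ho
  | prim _ ih => exact List.mem_cons_of_mem _ (ih ho)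
  | op hπ _ ih =>
    rcases List.mem_cons.1 ho with h | h
    · cases h; simp
    · simp [ih h]

theorem SeqRun.exec {c c' : Config n V VL ML M L} {s : List (Op V × Resp V)}
    (h : SeqRun A p c s c') :
    ∃ σ, Exec A c σ c' ∧ Blocks p σ s ∧ ∀ e ∈ σ, EventOf p e := by
  induction h with
  | nil c => exact ⟨[], .nil c, .nil, by simp⟩
  | @cons c c' c'' o r τ s hτ he _ ih =>
    obtain ⟨σ, h1, h2, h3⟩ := ih
    refine ⟨_, he.append h1, ?_, ?_⟩
    · have := Blocks.op (p := p) (o := o) (r := r) (fun e he => ⟨p, hτ e he⟩) h2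
      simpa using this
    · intro e he
      simp only [List.cons_append, List.append_assoc, List.mem_cons, List.mem_append,
        List.not_mem_nil, false_or] at he
      rcases he with rfl | he | rfl | he
      · rfl
      · exact (hτ e he).eventOf
      · rfl
      · exact h3 e he

theorem SeqRun.idle {c c' : Config n V VL ML M L} {s : List (Op V × Resp V)}
    (h : SeqRun A p c s c') : c'.busy p = false := by
  induction h with
  | nil c h => exact h
  | cons _ _ _ ih => exact ih

theorem SeqRun.idle_left {c c' : Config n V VL ML M L} {s : List (Op V × Resp V)}
    (h : SeqRun A p c s c') : c.busy p = false := by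
  cases h with
  | nil c h => exact h
  | cons _ he _ =>
    cases he with
    | cons s _ => cases s; assumption

theorem SeqRun.append {c c' c'' : Config n V VL ML M L} {s t : List (Op V × Resp V)}
    (h : SeqRun A p c s c') (h' : SeqRun A p c' t c'') : SeqRun A p c (s ++ t) c'' := by
  induction h with
  | nil => exact h'
  | cons hτ he _ ih => exact .cons hτ he (ih h')

theorem SeqRun.reachable {c c' : Config n V VL ML M L} {s : List (Op V × Resp V)}
    (h : SeqRun A p c s c') (hc : Reachable A c) : Reachable A c' := by
  obtain ⟨σ, h, -⟩ := h.exec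
  exact hc.exec h

theorem SeqRun.frame {c c' : Config n V VL ML M L} {s : List (Op V × Resp V)}
    (h : SeqRun A p c s c') : Frame p c c' := by
  obtain ⟨σ, h, -, h'⟩ := h.exec
  exact h.frame h'

theorem ObstructionFree.seqRun (hA : ObstructionFree A) {c : Config n V VL ML M L}
    (hc : Reachable A c) (hp : c.busy p = false) (o : Op V) :
    ∃ r c', SeqRun A p c [(o, r)] c' := by
  have h1 := Step.inv (A := A) c p o hp
  obtain ⟨τ, r, c', hτ, h2⟩ := hA _ (hc.exec (.single h1)) p (by simp)
  refine ⟨r, c', .cons hτ (.cons h1 h2) (.nil _ ?_)⟩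
  obtain ⟨d, -, h3⟩ := h2.split
  cases h3 with
  | cons s h3 =>
    cases h3
    cases s
    simp

/-! ### Solo runs depend only on the memory and on the state of the process -/

/-- The configurations agree in the memory and in the state of `p`. -/
def Agree (p : Fin n) (c d : Config n V VL ML M L) : Prop :=
  c.vmem = d.vmem ∧ c.mmem = d.mmem ∧ c.loc p = d.loc p ∧ c.busy p = d.busy p

/-- A step of `p` depends only on the memory and on the state of `p`. Thus solo runs can be replayed
after other processes have moved. -/
theorem Step.transfer {c c' d : Config n V VL ML M L} {e : Event n V VL ML M} (h : Step A c e c')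
    (he : EventOf p e) (hd : Agree p c d) : ∃ d', Step A d e d' ∧ Agree p c' d' := by
  obtain ⟨h1, h2, h3, h4⟩ := hd
  cases h with
  | inv q o hb =>
    cases he
    exact ⟨_, .inv d p o (h4 ▸ hb), h1, h2, by simp [h3], by simp⟩
  | prim q a hb ha =>
    cases he
    rw [h1, h2]
    refine ⟨_, .prim d p a (h4 ▸ hb) (h3 ▸ ha), rfl, rfl, ?_, h4⟩
    simp [h3]
  | res q r hb hr =>
    cases he
    exact ⟨_, .res d p r (h4 ▸ hb) (h3 ▸ hr), h1, h2, h3, by simp⟩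

theorem Exec.transfer {c c' d : Config n V VL ML M L} {σ : List (Event n V VL ML M)}
    (h : Exec A c σ c') (hσ : ∀ e ∈ σ, EventOf p e) (hd : Agree p c d) :
    ∃ d', Exec A d σ d' ∧ Agree p c' d' := by
  induction h generalizing d with
  | nil => exact ⟨d, .nil d, hd⟩
  | cons s _ ih =>
    obtain ⟨d', h1, h2⟩ := s.transfer (hσ _ (by simp)) hd
    obtain ⟨d'', h3, h4⟩ := ih (fun e he => hσ e (List.mem_cons_of_mem _ he)) h2
    exact ⟨d'', .cons h1 h3, h4⟩

theorem SeqRun.transfer {c c' d : Config n V VL ML M L} {s : List (Op V × Resp V)}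
    (h : SeqRun A p c s c') (hd : Agree p c d) : ∃ d', SeqRun A p d s d' := by
  induction h generalizing d with
  | nil c h => exact ⟨d, .nil d (hd.2.2.2 ▸ h)⟩
  | @cons c c' c'' o r τ s hτ he _ ih =>
    obtain ⟨d', h1, h2⟩ := he.transfer (p := p) (by
      intro e he
      simp only [List.mem_cons, List.mem_append, List.not_mem_nil, or_false] at he
      rcases he with rfl | he | rfl
      · rfl
      · exact (hτ e he).eventOf
      · rfl) hd
    obtain ⟨d'', h3⟩ := ih h2
    exact ⟨d'', .cons hτ h1 h3⟩

/-! ### Values outside the memory stay out of solo runs -/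

/-- At the end of `τ`, the current operation of `p`, if any, has not learnt `v`. -/
def Unlearned (p : Fin n) (v : V) (τ : List (Event n V VL ML M)) : Prop :=
  ∀ τ₁ e τ₂, τ = τ₁ ++ e :: τ₂ → Learns p v e → ∃ r, Event.res p r ∈ τ₂

theorem Unlearned.snoc {v : V} {τ : List (Event n V VL ML M)} {e : Event n V VL ML M}
    (h : Unlearned p v τ) (he : ¬ Learns p v e) : Unlearned p v (τ ++ [e]) := by
  intro τ₁ e' τ₂ heq hl
  rcases List.eq_nil_or_concat τ₂ with rfl | ⟨τ₂, f, rfl⟩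
  · have := List.append_inj_right' heq rfl
    simp only [List.cons.injEq, and_true] at this
    exact absurd hl (this ▸ he)
  · have : τ ++ [e] = (τ₁ ++ e' :: τ₂) ++ [f] := by simpa using heq
    obtain ⟨r, hr⟩ := h τ₁ e' τ₂ (List.append_inj_left' this rfl) hl
    exact ⟨r, by simp [hr]⟩

theorem Unlearned.res (v : V) (τ : List (Event n V VL ML M)) (r : Resp V) :
    Unlearned p v (τ ++ [.res p r]) := by
  intro τ₁ e' τ₂ heq hl
  rcases List.eq_nil_or_concat τ₂ with rfl | ⟨τ₂, f, rfl⟩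
  · have := List.append_inj_right' heq rfl
    simp only [List.cons.injEq, and_true] at this
    subst this
    rcases hl with ⟨_, h⟩ | h <;> cases h
  · have : τ ++ [.res p r] = (τ₁ ++ e' :: τ₂) ++ [f] := by simpa using heq
    have h2 := List.append_inj_right' this rfl
    simp only [List.cons.injEq, and_true] at h2
    exact ⟨r, by simp [h2]⟩

/-- An operation that learnt `v` and has not responded would keep `p` busy. -/
theorem unlearned_of_idle {c : Config n V VL ML M L} {τ : List (Event n V VL ML M)}
    (h : Exec A A.init τ c) (hp : c.busy p = false) (v : V) : Unlearned p v τ := by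
  rintro τ₁ e τ₂ rfl hl
  by_contra hcon
  push Not at hcon
  obtain ⟨d, -, h1⟩ := h.split
  cases h1 with
  | cons s h1 =>
    have := h1.busy_of_no_res (p := p) (by
      rcases hl with ⟨l, he⟩ | he
      · cases s with
        | prim q a hb => exact (Event.prim.inj he).1 ▸ hb
        | _ => cases he
      · cases s with
        | inv q o => simp [(Event.inv.inj he).1]
        | _ => cases he) hcon
    simp [hp] at this

/-- To use `v`, the operation must have learnt it; it can neither read `v`, which is in no location,
nor receive it as argument, by `hi`. -/
theorem Step.absent (hA : NonCreative A) {c c' : Config n V VL ML M L} {v : V}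
    {τ : List (Event n V VL ML M)} {e : Event n V VL ML M} (hτ : Exec A A.init τ c)
    (hu : Unlearned p v τ) (hv : ∀ l, c.vmem l ≠ some v) (h : Step A c e c') (he : EventOf p e)
    (hi : e ≠ .inv p (.enq v)) :
    Unlearned p v (τ ++ [e]) ∧ (∀ l, c'.vmem l ≠ some v) ∧ e ≠ .res p (.deqR (some v)) := by
  have huse : ¬ Uses p v e := by
    intro hue
    obtain ⟨τ₁, e', τ₂, h1, h2, h3⟩ := hA τ e c' (hτ.append (.single h)) p v hue
    obtain ⟨r, hr⟩ := hu τ₁ e' τ₂ h1 h2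
    exact h3 r hr
  refine ⟨?_, ?_, fun h => huse (.inr (.inr (.inr h)))⟩
  · cases h with
    | res q r => cases he; exact .res v τ r
    | inv q o =>
      refine hu.snoc ?_
      rintro (⟨l, h⟩ | h)
      · cases h
      · exact hi h
    | prim q a =>
      refine hu.snoc ?_
      rintro (⟨l, h⟩ | h)
      · simp only [Event.prim.injEq] at h
        obtain ⟨rfl, rfl, h⟩ := h
        simp only [primResp, PrimResp.value.injEq] at h
        exact hv l h
      · cases h
  · intro l
    cases h with
    | res => exact hv l
    | inv => exact hv l
    | prim q a hb ha =>
      cases he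
      cases a with
      | writeV k w =>
        simp only [primV, Function.update_apply]
        split
        · rintro rfl; exact huse (.inl ⟨_, _, rfl⟩)
        · exact hv l
      | casV k old new =>
        simp only [primV]
        split
        · simp only [Function.update_apply]
          split
          · rintro rfl; exact huse (.inr (.inr (.inl ⟨_, _, _, rfl⟩)))
          · exact hv l
        · exact hv l
      | _ => exact hv l

theorem Exec.absent (hA : NonCreative A) {c c' : Config n V VL ML M L} {v : V}
    {τ σ : List (Event n V VL ML M)} (hτ : Exec A A.init τ c)
    (hu : Unlearned p v τ) (hv : ∀ l, c.vmem l ≠ some v) (h : Exec A c σ c')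
    (hσ : ∀ e ∈ σ, EventOf p e) (hi : Event.inv p (.enq v) ∉ σ) :
    (∀ l, c'.vmem l ≠ some v) ∧ Event.res p (.deqR (some v)) ∉ σ := by
  induction h generalizing τ with
  | nil => exact ⟨hv, by simp⟩
  | @cons c c' c'' e σ s _ ih =>
    obtain ⟨h1, h2, h3⟩ := s.absent hA hτ hu hv (hσ _ (by simp)) (fun h => hi (by simp [h]))
    obtain ⟨h4, h5⟩ := ih (hτ.append (.single s)) h1 h2
      (fun e he => hσ e (List.mem_cons_of_mem _ he)) fun h => hi (List.mem_cons_of_mem _ h)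
    exact ⟨h4, by simp [h5, h3.symm]⟩

theorem SeqRun.absent (hA : NonCreative A) {c c' : Config n V VL ML M L} {v : V}
    {s : List (Op V × Resp V)} (hc : Reachable A c) (h : SeqRun A p c s c')
    (hv : ∀ l, c.vmem l ≠ some v) (hs : ∀ r, (Op.enq v, r) ∉ s) :
    (∀ l, c'.vmem l ≠ some v) ∧ ∀ o, (o, Resp.deqR (some v)) ∉ s := by
  obtain ⟨τ, hτ⟩ := hc
  obtain ⟨σ, h1, h2, h3⟩ := h.exec
  obtain ⟨h4, h5⟩ := Exec.absent hA hτ (unlearned_of_idle hτ h.idle_left v) hv h1 h3 (by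
    intro hi
    obtain ⟨-, r, hr⟩ := h2.inv_mem hi
    exact hs r hr)
  exact ⟨h4, fun o ho => h5 (h2.res_mem ho)⟩

/-! ### Pending operations -/

/-- In `τ`, process `q` has invoked `o`, without a response so far. -/
def Pending (τ : List (Event n V VL ML M)) (q : Fin n) (o : Op V) : Prop :=
  ∃ τ₁ τ₂, τ = τ₁ ++ .inv q o :: τ₂ ∧ ∀ r, Event.res q r ∉ τ₂

/-- The process stays busy after the earlier invocation, so it cannot make the later one. -/
theorem pending_unique {c d : Config n V VL ML M L} {τ₁ τ₂ τ₁' τ₂' : List (Event n V VL ML M)}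
    {q : Fin n} {o o' : Op V} (h : Exec A c (τ₁ ++ .inv q o :: τ₂) d)
    (h1 : ∀ r, Event.res q r ∉ τ₂) (heq : τ₁ ++ .inv q o :: τ₂ = τ₁' ++ .inv q o' :: τ₂')
    (hlt : τ₁.length < τ₁'.length) : False := by
  obtain ⟨ρ, rfl⟩ : τ₁ <+: τ₁' := List.prefix_of_prefix_length_le (List.prefix_append _ _)
    (heq.symm ▸ List.prefix_append _ _) hlt.le
  cases ρ with
  | nil => simp at hlt
  | cons e ρ =>
    simp only [List.append_assoc, List.cons_append, List.append_cancel_left_eq,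
      List.cons.injEq] at heq
    obtain ⟨rfl, rfl⟩ := heq
    obtain ⟨d, -, h⟩ := h.split
    cases h with
    | cons s h =>
      obtain ⟨d', h2, h3⟩ := h.split
      have := h2.busy_of_no_res (p := q) (by cases s; simp) fun r hr => h1 r (by simp [hr])
      cases h3 with
      | cons s h3 =>
        cases s
        simp_all

theorem Pending.unique {c d : Config n V VL ML M L} {τ : List (Event n V VL ML M)} {q : Fin n}
    {o o' : Op V} (hτ : Exec A c τ d) (h : Pending τ q o) (h' : Pending τ q o') : o = o' := by
  obtain ⟨τ₁, τ₂, rfl, h1⟩ := h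
  obtain ⟨τ₁', τ₂', h2, h3⟩ := h'
  rcases lt_trichotomy τ₁.length τ₁'.length with h | h | h
  · exact (pending_unique hτ h1 h2 h).elim
  · obtain ⟨-, h4⟩ := List.append_inj h2 h
    simp at h4
    exact h4.1
  · exact (pending_unique (h2 ▸ hτ) h3 h2.symm h).elim

end Executions

/-! ### Consequences of linearizability for solo runs; stable configurations -/

section Linearization
variable {n : ℕ} {V VL ML M L : Type*} {A : Implementation n V VL ML M L} {p : Fin n} {C : ℕ}

/-- Linearizations name operations by position, so the operations of `s` need positions. The prefix
`ρ` is arbitrary for the induction; the last clause says that there are no other invocations after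
it. -/
theorem Blocks.index {σ : List (Event n V VL ML M)} {s : List (Op V × Resp V)}
    (h : Blocks p σ s) (ρ : List (Event n V VL ML M)) :
    ∃ I : List (ℕ × Op V × Resp V), I.map Prod.snd = s ∧
      (∀ x ∈ I, ρ.length ≤ x.1 ∧ ∃ j, CompletesAt (ρ ++ σ) x.1 j x.2.1 x.2.2) ∧
      I.Pairwise (fun x y => x.1 < y.1 ∧ Precedes (ρ ++ σ) x.1 y.1) ∧
      ∀ i q o, ρ.length ≤ i → (ρ ++ σ)[i]? = some (.inv q o) → ∃ r, (i, o, r) ∈ I := by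
  induction h generalizing ρ with
  | nil =>
    refine ⟨[], rfl, by simp, by simp, fun i q o hi h => ?_⟩
    rw [List.getElem?_eq_none (by simpa using hi)] at h
    cases h
  | @prim q a r σ s _ ih =>
    obtain ⟨I, h1, h2, h3, h4⟩ := ih (ρ ++ [.prim q a r])
    simp only [List.append_assoc, List.singleton_append, List.length_append,
      List.length_singleton] at h2 h3 h4
    refine ⟨I, h1, fun x hx => ⟨by have := (h2 x hx).1; omega, (h2 x hx).2⟩, h3,
      fun i q' o hi h => ?_⟩
    rcases hi.eq_or_lt with rfl | hi
    · simp at h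
    · exact h4 i q' o hi h
  | @op o r π σ s hπ _ ih =>
    obtain ⟨I, h1, h2, h3, h4⟩ := ih (ρ ++ .inv p o :: (π ++ [.res p r]))
    have hassoc : (ρ ++ .inv p o :: (π ++ [.res p r])) ++ σ
      = ρ ++ .inv p o :: (π ++ .res p r :: σ) := by simp
    rw [hassoc] at h2 h3 h4
    simp only [List.length_append, List.length_cons, List.length_nil, zero_add] at h2 h4
    set τ := ρ ++ .inv p o :: (π ++ .res p r :: σ) with hτ
    have hmid : ∀ k e, ρ.length < k → k < ρ.length + π.length + 1 → τ[k]? = some e → e ∈ π := by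
      intro k e hk hk' he
      obtain ⟨t, rfl⟩ := Nat.exists_eq_add_of_lt hk
      rw [hτ, List.getElem?_append_right (by omega),
        show ρ.length + t + 1 - ρ.length = t + 1 by omega, List.getElem?_cons_succ,
        List.getElem?_append_left (by omega)] at he
      exact List.mem_of_getElem? he
    have hend : τ[ρ.length + π.length + 1]? = some (.res p r) := by
      rw [hτ, List.getElem?_append_right (by omega),
        show ρ.length + π.length + 1 - ρ.length = π.length + 1 by omega, List.getElem?_cons_succ,
        List.getElem?_append_right le_rfl]
      simp
    have hc : CompletesAt τ ρ.length (ρ.length + π.length + 1) o r := by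
      refine ⟨p, by simp [hτ], hend, by omega, fun k r' hk hk' he => ?_⟩
      obtain ⟨q, a, r'', h⟩ := hπ _ (hmid k _ hk hk' he)
      cases h
    refine ⟨(ρ.length, o, r) :: I, by simp [h1], ?_, ?_, ?_⟩
    · rintro x hx
      rcases List.mem_cons.1 hx with rfl | hx
      · exact ⟨le_rfl, _, hc⟩
      · exact ⟨by have := (h2 x hx).1; omega, (h2 x hx).2⟩
    · refine List.pairwise_cons.2 ⟨fun x hx => ?_, h3⟩
      have := (h2 x hx).1
      exact ⟨by simp only; omega, _, _, _, hc, by omega⟩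
    · intro i q o' hi h
      rcases hi.eq_or_lt with rfl | hi
      · simp only [hτ, le_refl, List.getElem?_append_right, Nat.sub_self,
          List.getElem?_cons_zero, Option.some.injEq, Event.inv.injEq] at h
        exact ⟨r, by simp [h.2]⟩
      · rcases lt_trichotomy i (ρ.length + π.length + 1) with hlt | rfl | hlt
        · obtain ⟨q', a, r'', h⟩ := hπ _ (hmid i _ hi hlt h)
          cases h
        · rw [hend] at h; cases h
        · obtain ⟨r', h⟩ := h4 i q o' (by omega) h
          exact ⟨r', List.mem_cons_of_mem _ h⟩

theorem exists_completesAt {τ₀ σ : List (Event n V VL ML M)} {i : ℕ} {q : Fin n} {o : Op V}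
    (hi : τ₀[i]? = some (.inv q o)) (hr : ∃ r, Event.res q r ∈ τ₀.drop (i + 1)) :
    ∃ j r, CompletesAt (τ₀ ++ σ) i j o r ∧ j < τ₀.length := by
  classical
  have hex : ∃ j, i < j ∧ j < τ₀.length ∧ ∃ r, τ₀[j]? = some (.res q r) := by
    obtain ⟨r, hr⟩ := hr
    obtain ⟨t, ht⟩ := List.mem_iff_getElem?.1 hr
    rw [List.getElem?_drop] at ht
    exact ⟨i + 1 + t, by omega, (List.getElem?_eq_some_iff.1 ht).1, r, ht⟩
  obtain ⟨h1, h2, r, h3⟩ := Nat.find_spec hex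
  have happ : ∀ k, k < τ₀.length → (τ₀ ++ σ)[k]? = τ₀[k]? := fun k hk =>
    List.getElem?_append_left hk
  refine ⟨Nat.find hex, r, ⟨q, ?_, ?_, h1, ?_⟩, h2⟩
  · rw [happ _ (by omega), hi]
  · rw [happ _ h2, h3]
  · intro k r' hk hk' h
    rw [happ _ (by omega)] at h
    exact Nat.find_min hex hk' ⟨hk, by omega, r', h⟩

/-- What linearizability says about operations that `p` executes while the operations of the
other processes stay pending, once `p` has found the queue empty. -/
theorem LinearizableTrace.own_ops {τ₀ σ : List (Event n V VL ML M)} {s : List (Op V × Resp V)}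
    {c : Config n V VL ML M L} (hτ : Exec A A.init τ₀ c)
    (hσ : Blocks p σ ((.deq, .deqR none) :: s)) (hlin : LinearizableTrace C (τ₀ ++ σ)) :
    ∃ u : List (Option (Fin n) × Op V × Resp V), Legal C [] (u.map Prod.snd) ∧ own u = s ∧
      (u.filterMap Prod.fst).Nodup ∧ ∀ q o r, (some q, o, r) ∈ u → Pending τ₀ q o := by
  obtain ⟨S, hnd, hinv, hcomp, hpw, hleg⟩ := hlin
  obtain ⟨I, hI, hI2, hI3, hI4⟩ := hσ.index τ₀
  cases I with
  | nil => simp at hI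
  | cons x I =>
  obtain ⟨i₁, o₁, r₁⟩ := x
  simp only [List.map_cons, List.cons.injEq, Prod.mk.injEq] at hI
  obtain ⟨⟨rfl, rfl⟩, hI⟩ := hI
  have hIS : ∀ x ∈ (i₁, Op.deq, Resp.deqR none) :: I, x ∈ S := fun x hx => by
    obtain ⟨-, j, hj⟩ := hI2 x hx
    exact hcomp _ _ _ _ hj
  obtain ⟨S₁, S₂, rfl⟩ := List.append_of_mem (hIS _ List.mem_cons_self)
  obtain ⟨hI5, hI3⟩ := List.pairwise_cons.1 hI3
  have hi₁ : τ₀.length ≤ i₁ := (hI2 _ List.mem_cons_self).1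
  have hkey : ∀ x y, x ∈ S₁ ++ (i₁, Op.deq, Resp.deqR none) :: S₂ →
      y ∈ S₁ ++ (i₁, Op.deq, Resp.deqR none) :: S₂ → x.1 = y.1 → x = y := fun x y hx hy h =>
    List.inj_on_of_nodup_map hnd hx hy h
  rw [List.pairwise_append, List.pairwise_cons] at hpw
  obtain ⟨-, ⟨hpw1, hpw2⟩, hpw3⟩ := hpw
  have hnd2 : (S₂.map Prod.fst).Nodup ∧ ∀ x ∈ S₂, x.1 ≠ i₁ := by
    rw [List.map_append, List.map_cons, List.nodup_append, List.nodup_cons] at hnd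
    refine ⟨hnd.2.1.2, fun x hx h => hnd.2.1.1 ?_⟩
    simp only
    rw [← h]
    exact List.mem_map_of_mem (f := Prod.fst) hx
  -- The later operations of `p` are preceded in real time by its unsuccessful dequeue, so all of
  -- them are in `S₂`.
  have hmem : ∀ x, x ∈ S₂.filter (fun x => decide (τ₀.length ≤ x.1)) ↔ x ∈ I := by
    intro x
    simp only [List.mem_filter, decide_eq_true_eq]
    constructor
    · rintro ⟨hx, hle⟩
      obtain ⟨q, hq⟩ := hinv x (by simp [hx])
      obtain ⟨r, hr⟩ := hI4 _ _ _ hle hq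
      have := hkey x _ (by simp [hx]) (hIS _ hr) rfl
      rw [← this] at hr
      rcases List.mem_cons.1 hr with h | h
      · exact absurd (congrArg Prod.fst h) (hnd2.2 x hx)
      · exact h
    · intro hx
      have hm := List.mem_cons_of_mem (i₁, Op.deq, Resp.deqR none) hx
      refine ⟨?_, (hI2 _ hm).1⟩
      rcases List.mem_append.1 (hIS _ hm) with h | h
      · exact absurd (hI5 _ hx).2 (hpw3 _ h _ List.mem_cons_self)
      · rcases List.mem_cons.1 h with h | h
        · have := (hI5 _ hx).1
          rw [h] at this
          exact absurd this (lt_irrefl _)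
        · exact h
  have htot : ∀ x ∈ I, ∀ y ∈ I, x.1 < y.1 → Precedes (τ₀ ++ σ) x.1 y.1 := by
    have : ∀ J : List (ℕ × Op V × Resp V),
        J.Pairwise (fun x y => x.1 < y.1 ∧ Precedes (τ₀ ++ σ) x.1 y.1) →
        ∀ x ∈ J, ∀ y ∈ J, x.1 < y.1 → Precedes (τ₀ ++ σ) x.1 y.1 := by
      intro J hJ
      induction J with
      | nil => simp
      | cons z J ih =>
        obtain ⟨h1, h2⟩ := List.pairwise_cons.1 hJ
        intro x hx y hy hlt
        rcases List.mem_cons.1 hx with rfl | hx' <;> rcases List.mem_cons.1 hy with rfl | hy'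
        · exact absurd hlt (lt_irrefl _)
        · exact (h1 _ hy').2
        · exact absurd hlt (h1 _ hx').1.not_gt
        · exact ih h2 x hx' y hy' hlt
    exact this I hI3
  have hfilter : S₂.filter (fun x => decide (τ₀.length ≤ x.1)) = I := by
    have hS : (S₂.filter fun x => decide (τ₀.length ≤ x.1)).Pairwise fun x y => x.1 < y.1 := by
      have h1 : (S₂.filter fun x => decide (τ₀.length ≤ x.1)).Pairwise
          fun x y => x.1 ≠ y.1 ∧ ¬ Precedes (τ₀ ++ σ) y.1 x.1 :=
        (List.Pairwise.and (List.pairwise_map.1 hnd2.1) hpw2).sublist List.filter_sublist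
      refine h1.imp_of_mem fun {x y} hx hy h => ?_
      rcases lt_or_gt_of_ne h.1 with h' | h'
      · exact h'
      · exact absurd (htot _ ((hmem y).1 hy) _ ((hmem x).1 hx) h') h.2
    refine List.Perm.eq_of_pairwise (le := fun x y => x.1 < y.1) ?_ hS (hI3.imp fun h => h.1) ?_
    · intro a b _ _ h h'
      exact absurd h' h.not_gt
    · refine (List.perm_ext_iff_of_nodup ?_ ?_).2 hmem
      · exact hS.imp fun h h' => absurd h (by rw [h']; exact lt_irrefl _)
      · exact hI3.imp fun h h' => absurd h.1 (by rw [h']; exact lt_irrefl _)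
  -- An operation completed within `τ₀` precedes the unsuccessful dequeue and cannot be linearized
  -- after it.
  have hpend : ∀ x ∈ S₂, x.1 < τ₀.length → ∃ q, τ₀[x.1]? = some (.inv q x.2.1) ∧
      ∀ r, Event.res q r ∉ τ₀.drop (x.1 + 1) := by
    intro x hx hlt
    obtain ⟨q, hq⟩ := hinv x (by simp [hx])
    rw [List.getElem?_append_left hlt] at hq
    refine ⟨q, hq, fun r hr => ?_⟩
    obtain ⟨j, r', h1, h2⟩ := exists_completesAt (σ := σ) hq ⟨r, hr⟩
    exact hpw1 _ hx ⟨j, _, _, h1, by simp only; omega⟩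
  have hsplit : ∀ i e, τ₀[i]? = some e → τ₀ = τ₀.take i ++ e :: τ₀.drop (i + 1) := by
    intro i e h
    obtain ⟨h1, rfl⟩ := List.getElem?_eq_some_iff.1 h
    simp
  have : Nonempty (Fin n) := ⟨p⟩
  choose! g hg1 hg2 using hpend
  refine ⟨S₂.map fun x => (if τ₀.length ≤ x.1 then none else some (g x), x.2), ?_, ?_, ?_, ?_⟩
  · rw [List.map_append, List.map_cons, legal_append] at hleg
    obtain ⟨-, h1, h2⟩ := hleg
    rw [eq_nil_of_seqStep_deq h1] at h2
    rw [List.map_map]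
    exact h2
  · rw [own, List.filter_map, List.map_map, ← hI, ← hfilter]
    have : (fun t : Option (Fin n) × Op V × Resp V => t.1.isNone) ∘
        (fun x : ℕ × Op V × Resp V => (if τ₀.length ≤ x.1 then none else some (g x), x.2)) =
        fun x => decide (τ₀.length ≤ x.1) := by
      funext x
      by_cases h : τ₀.length ≤ x.1 <;> simp [h]
    rw [this]
    rfl
  · rw [List.filterMap_map]
    have h1 : S₂.Pairwise fun x y => x.1 ≠ y.1 := List.pairwise_map.1 hnd2.1
    refine List.Pairwise.filterMap _ ?_ (h1.imp_of_mem (S := fun x y => x ∈ S₂ ∧ y ∈ S₂ ∧ x.1 ≠ y.1)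
      fun hx hy h => ⟨hx, hy, h⟩)
    rintro x y ⟨hx, hy, hne⟩ a ha b hb rfl
    simp only [Function.comp_apply] at ha hb
    split at ha
    · cases ha
    split at hb
    · cases hb
    rename_i hx' hy'
    simp only [Option.some.injEq] at ha hb
    push Not at hx' hy'
    have ex := hsplit _ _ (hg1 x hx hx')
    have ey := hsplit _ _ (hg1 y hy hy')
    rw [ha] at ex
    rw [hb] at ey
    have nx := hg2 x hx hx'
    have ny := hg2 y hy hy'
    rw [ha] at nx
    rw [hb] at ny
    rcases lt_or_gt_of_ne hne with h | h
    · exact pending_unique (ex ▸ hτ) nx (ex.symm.trans ey) (by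
        simp only [List.length_take]; omega)
    · exact pending_unique (ey ▸ hτ) ny (ey.symm.trans ex) (by
        simp only [List.length_take]; omega)
  · intro q o r h
    simp only [List.mem_map, Prod.mk.injEq] at h
    obtain ⟨x, hx, h1, h2⟩ := h
    split at h1
    · cases h1
    rename_i hx'
    push Not at hx'
    simp only [Option.some.injEq] at h1
    have := hsplit _ _ (hg1 x hx hx')
    rw [h1, h2] at this
    exact ⟨_, _, this, h1 ▸ hg2 x hx hx'⟩

/-- The queue holds at most as many elements as there are events. -/
theorem LinearizableTrace.length_deqs_le {τ₀ σ : List (Event n V VL ML M)} {vs : List V}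
    (hσ : Blocks p σ (vs.map fun v => (Op.deq, Resp.deqR (some v))))
    (hlin : LinearizableTrace C (τ₀ ++ σ)) : vs.length ≤ τ₀.length := by
  obtain ⟨S, hnd, hinv, hcomp, hpw, hleg⟩ := hlin
  obtain ⟨I, hI, hI2, hI3, hI4⟩ := hσ.index τ₀
  have hInd : I.Nodup := hI3.imp fun h h' => absurd h.1 (by rw [h']; exact lt_irrefl _)
  have hIS : I.Subperm S := hInd.subperm fun x hx => by
    obtain ⟨-, j, hj⟩ := hI2 x hx
    exact hcomp _ _ _ _ hj
  have h1 : vs.length ≤ (deqs (S.map Prod.snd)).length := by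
    obtain ⟨l, hl, hs⟩ := hIS
    have h2 := congrArg List.length (deqs_map_deq vs)
    rw [← hI] at h2
    rw [← h2]
    exact (((hl.map Prod.snd).filterMap _).length_eq.symm).trans_le
      ((hs.map Prod.snd).filterMap _).length_le
  refine h1.trans ((BQueue.length_deqs_le hleg).trans ?_)
  -- There are no enqueues in `σ`, so each enqueue in the linearization was invoked by an event of
  -- `τ₀`.
  have h2 : ∀ T : List (ℕ × Op V × Resp V), (∀ x ∈ T, x ∈ S) →
      (enqs (T.map Prod.snd)).length ≤
        ((T.map Prod.fst).filter fun i => decide (i < τ₀.length)).length := by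
    intro T hT
    induction T with
    | nil => simp [enqs]
    | cons x T ih =>
      have ih := ih fun y hy => hT y (List.mem_cons_of_mem _ hy)
      obtain ⟨i, o, r⟩ := x
      cases o with
      | deq =>
        have : enqs (((i, Op.deq, r) :: T).map Prod.snd) = enqs (T.map Prod.snd) := by
          simp [enqs]
        rw [this]
        refine ih.trans ?_
        exact ((List.sublist_cons_self i (T.map Prod.fst)).filter _).length_le
      | enq v =>
        have hlt : i < τ₀.length := by
          by_contra hge
          obtain ⟨q, hq⟩ := hinv _ (hT _ List.mem_cons_self)
          obtain ⟨r', h⟩ := hI4 _ _ _ (not_lt.1 hge) hq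
          have := List.mem_map_of_mem (f := Prod.snd) h
          rw [hI] at this
          simp at this
        have : (enqs ((Op.enq v, r) :: T.map Prod.snd)).length ≤
            (enqs (T.map Prod.snd)).length + 1 := by
          simp only [enqs, List.filterMap_cons]
          split <;> simp
        simp only [List.map_cons, List.filter_cons, hlt, decide_true, if_true, List.length_cons]
        omega
  refine (h2 S fun x hx => hx).trans ?_
  have h3 := (hnd.filter fun i => decide (i < τ₀.length)).subperm
    (l₂ := List.range τ₀.length) fun i hi => by simpa using (List.mem_filter.1 hi).2
  simpa using h3.length_le

/-! ### Stable configurations -/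

/-- From `c`, process `p` alone finds a queue whose contents are `q`. -/
def Stable (A : Implementation n V VL ML M L) (C : ℕ) (p : Fin n) (c : Config n V VL ML M L)
    (q : List V) : Prop :=
  Reachable A c ∧ c.busy p = false ∧ ∀ s c', SeqRun A p c s c' → Legal C q s

theorem Stable.run {c c' : Config n V VL ML M L} {q : List V} {s : List (Op V × Resp V)}
    (h : Stable A C p c q) (hs : SeqRun A p c s c') : Stable A C p c' (final C q s) :=
  ⟨hs.reachable h.1, hs.idle, fun _ _ ht =>
    ((legal_append _ _ _).1 (h.2.2 _ _ (hs.append ht))).2⟩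

theorem Stable.op (hA : ObstructionFree A) {c : Config n V VL ML M L} {q : List V}
    (h : Stable A C p c q) (o : Op V) :
    ∃ c', SeqRun A p c [(o, (seqStep C q o).2)] c' ∧ Stable A C p c' (seqStep C q o).1 := by
  obtain ⟨r, c', hr⟩ := hA.seqRun h.1 h.2.1 o
  obtain ⟨rfl, -⟩ := h.2.2 _ _ hr
  exact ⟨c', hr, h.run hr⟩

theorem Stable.enq (hA : ObstructionFree A) {c : Config n V VL ML M L} {q e : List V}
    (h : Stable A C p c q) (he : q.length + e.length ≤ C) :
    ∃ c', SeqRun A p c (e.map fun v => (Op.enq v, Resp.enqR true)) c' ∧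
      Stable A C p c' (q ++ e) := by
  induction e generalizing c q with
  | nil => exact ⟨c, .nil c h.2.1, by simpa using h⟩
  | cons v e ih =>
    obtain ⟨c', h1, h2⟩ := h.op hA (.enq v)
    simp only [List.length_cons] at he
    have hs : seqStep C q (.enq v) = (q ++ [v], .enqR true) := by
      simp [seqStep, show q.length < C by omega]
    rw [hs] at h1 h2
    obtain ⟨c'', h3, h4⟩ := ih h2 (by simp; omega)
    exact ⟨c'', h1.append h3, by simpa using h4⟩

theorem Stable.deq (hA : ObstructionFree A) {c : Config n V VL ML M L} {q : List V}
    (h : Stable A C p c q) :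
    ∃ c', SeqRun A p c (q.map fun v => (Op.deq, Resp.deqR (some v))) c' ∧
      Stable A C p c' [] := by
  induction q generalizing c with
  | nil => exact ⟨c, .nil c h.2.1, h⟩
  | cons v q ih =>
    obtain ⟨c', h1, h2⟩ := h.op hA .deq
    obtain ⟨c'', h3, h4⟩ := ih h2
    exact ⟨c'', h1.append h3, h4⟩

/-- The number of consecutive successful dequeues is bounded by the number of earlier events, so
some dequeue returns ⊥. -/
theorem exists_drain (hA : ObstructionFree A) (hL : Linearizable C A)
    {c : Config n V VL ML M L} (hc : Reachable A c) (hp : c.busy p = false) :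
    ∃ (vs : List V) (c₁ c₂ : Config n V VL ML M L),
      SeqRun A p c (vs.map fun v => (Op.deq, Resp.deqR (some v))) c₁ ∧
      SeqRun A p c₁ [(.deq, .deqR none)] c₂ := by
  obtain ⟨τ, hτ⟩ := hc
  have hlin : ∀ (vs : List V) (t : List (Op V × Resp V)) c',
      SeqRun A p c ((vs.map fun v => (Op.deq, Resp.deqR (some v))) ++ t) c' → t = [] →
      vs.length ≤ τ.length := by
    rintro vs t c' h rfl
    rw [List.append_nil] at h
    obtain ⟨σ, h1, h2, -⟩ := h.exec
    exact LinearizableTrace.length_deqs_le h2 (hL _ _ (hτ.append h1))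
  by_contra hcon
  push Not at hcon
  have : ∀ k, ∃ (vs : List V) (c' : Config n V VL ML M L), vs.length = k ∧
      SeqRun A p c (vs.map fun v => (Op.deq, Resp.deqR (some v))) c' := by
    intro k
    induction k with
    | zero => exact ⟨[], c, rfl, .nil c hp⟩
    | succ k ih =>
      obtain ⟨vs, c', rfl, h⟩ := ih
      obtain ⟨r, c'', h'⟩ := hA.seqRun (h.reachable ⟨τ, hτ⟩) h.idle .deq
      have hr : ∃ v, r = .deqR (some v) := by
        obtain ⟨σ, h1, h2, -⟩ := (h.append h').exec
        obtain ⟨S, -, -, hcomp, -, hleg⟩ := hL _ _ (hτ.append h1)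
        obtain ⟨I, hI, hI2, -⟩ := h2.index τ
        have hm : (Op.deq, r) ∈ I.map Prod.snd := by rw [hI]; simp
        obtain ⟨x, hx, hx2⟩ := List.mem_map.1 hm
        obtain ⟨-, j, hj⟩ := hI2 x hx
        obtain ⟨S₁, S₂, rfl⟩ := List.append_of_mem (hcomp _ _ _ _ hj)
        rw [List.map_append, List.map_cons, legal_append] at hleg
        have h3 := hleg.2.1
        rw [hx2] at h3
        simp only at h3
        cases hq : final C [] (S₁.map Prod.snd) with
        | nil =>
          rw [hq] at h3
          subst h3
          exact absurd h' (hcon _ _ _ h)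
        | cons y q =>
          rw [hq] at h3
          exact ⟨y, h3.symm⟩
      obtain ⟨v, rfl⟩ := hr
      refine ⟨vs ++ [v], c'', by simp, ?_⟩
      rw [List.map_append]
      exact h.append h'
  obtain ⟨vs, c', h1, h2⟩ := this (τ.length + 1)
  have := hlin vs [] c' (by simpa using h2) rfl
  omega

/-- Alone, a process reaches a stable configuration with an empty queue: every deviation from the
sequential behaviour uses up a pending operation. -/
theorem exists_stable (hA : ObstructionFree A) (hL : Linearizable C A)
    {c : Config n V VL ML M L} (hc : Reachable A c) (hp : c.busy p = false) :
    ∃ s c', SeqRun A p c s c' ∧ Stable A C p c' [] := by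
  obtain ⟨vs, c₁, c₂, h1, h2⟩ := exists_drain hA hL hc hp
  by_contra hcon
  have hbad : ∀ s c', SeqRun A p c s c' → ∃ t c'', SeqRun A p c' t c'' ∧ ¬ Legal C [] t := by
    intro s c' hs
    by_contra h
    push Not at h
    exact hcon ⟨s, c', hs, hs.reachable hc, hs.idle, h⟩
  have hchain : ∀ k, ∃ (ws : List (List (Op V × Resp V))) (c' : Config n V VL ML M L),
      ws.length = k ∧ (∀ w ∈ ws, ¬ Legal C [] w) ∧
      SeqRun A p c₂ (ws.map fun w => w ++ [(Op.deq, Resp.deqR none)]).flatten c' := by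
    intro k
    induction k with
    | zero => exact ⟨[], c₂, rfl, by simp, .nil _ h2.idle⟩
    | succ k ih =>
      obtain ⟨ws, c', rfl, h3, h4⟩ := ih
      have hrun := (h1.append h2).append h4
      obtain ⟨t, c'', h5, h6⟩ := hbad _ _ hrun
      obtain ⟨us, d₁, d₂, h7, h8⟩ := exists_drain hA hL
        ((hrun.append h5).reachable hc) h5.idle
      refine ⟨ws ++ [t ++ us.map fun v => (Op.deq, Resp.deqR (some v))], d₂, by simp, ?_, ?_⟩
      · intro w hw
        rcases List.mem_append.1 hw with hw | hw
        · exact h3 w hw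
        · rw [List.mem_singleton.1 hw, legal_append]
          exact fun h => h6 h.1
      · have := h4.append ((h5.append h7).append h8)
        simpa using this
  -- These `n + 1` illegal segments would need as many pending operations, but each process has at
  -- most one.
  obtain ⟨ws, c', h3, h4, h5⟩ := hchain (n + 1)
  obtain ⟨τ, hτ⟩ := h1.reachable hc
  obtain ⟨σ, h6, h7, -⟩ := (h2.append h5).exec
  obtain ⟨u, h8, h9, h10, -⟩ := LinearizableTrace.own_ops hτ h7 (hL _ _ (hτ.append h6))
  have h11 := length_le_of_segments h8 h9 h4
  have h12 : (u.filterMap Prod.fst).length ≤ n := by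
    simpa using h10.length_le_card
  omega

end Linearization

/-! ### Poised processes and the growth of the covered set -/

section Covering
variable {n : ℕ} {V VL ML M L : Type*} {A : Implementation n V VL ML M L} {p : Fin n} {C : ℕ}

/-- Otherwise `p` would return, while emptying the queue, a value that it cannot learn. -/
theorem Stable.mem (hA : ObstructionFree A) (hN : NonCreative A) {c : Config n V VL ML M L}
    {q : List V} (h : Stable A C p c q) {v : V} (hv : v ∈ q) : ∃ l, c.vmem l = some v := by
  by_contra hcon
  push Not at hcon
  obtain ⟨c', h1, -⟩ := h.deq hA
  exact (h1.absent hN h.1 hcon (by simp)).2 .deq (List.mem_map_of_mem hv)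

theorem card_le_of_mem [Fintype VL] {vm : VL → Option V} {X : Finset V}
    (h : ∀ v ∈ X, ∃ l, vm l = some v) : X.card ≤ Fintype.card VL := by
  rcases X.eq_empty_or_nonempty with rfl | ⟨v₀, hv₀⟩
  · simp
  have : Nonempty VL := ⟨(h v₀ hv₀).choose⟩
  choose! g hg using h
  refine Finset.card_le_card_of_injOn (t := Finset.univ) g (by simp) ?_
  intro v hv v' hv' heq
  have h1 := hg v hv
  rw [heq, hg v' hv'] at h1
  exact (Option.some.inj h1).symm

theorem exists_fresh {T : Finset V} {k : ℕ} (h : ((T.card + k : ℕ) : ℕ∞) ≤ ENat.card V) :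
    ∃ f : Fin k → V, Function.Injective f ∧ ∀ i, f i ∉ T := by
  classical
  obtain ⟨X, hX⟩ : ∃ X : Finset V, X.card = T.card + k := by
    rw [← Set.encard_univ] at h
    obtain ⟨X, -, hX⟩ := Set.exists_subset_encard_eq h
    have hfin := Set.finite_of_encard_eq_coe hX
    refine ⟨hfin.toFinset, ?_⟩
    rw [hfin.encard_eq_coe_toFinset_card] at hX
    exact_mod_cast hX
  have hk : k ≤ (X \ T).card := by
    have := Finset.le_card_sdiff T X
    omega
  obtain ⟨Y, hY, hYk⟩ := Finset.exists_subset_card_eq hk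
  refine ⟨fun i => (Y.equivFin.symm (i.cast hYk.symm) : V), ?_, fun i hi => ?_⟩
  · intro i j hij
    simpa using hij
  · exact (Finset.mem_sdiff.1 (hY (Y.equivFin.symm (i.cast hYk.symm)).2)).2 hi

theorem exists_finset_of_option {ι : Type*} [Fintype ι] (g : ι → Option V) :
    ∃ T : Finset V, T.card ≤ Fintype.card ι ∧ ∀ i v, g i = some v → v ∈ T := by
  classical
  refine ⟨Finset.eraseNone (Finset.univ.image g), ?_, fun i v h => ?_⟩
  · refine (Finset.card_eraseNone_le _).trans Finset.card_image_le
  · rw [Finset.mem_eraseNone, ← h]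
    exact Finset.mem_image_of_mem _ (Finset.mem_univ i)

/-! ### Poised processes -/

/-- The next step of `q` turns the content `x` of `l` into `y`. -/
def Hit (A : Implementation n V VL ML M L) (c : Config n V VL ML M L) (q : Fin n) (l : VL)
    (x y : Option V) : Prop :=
  c.busy q = true ∧
    (A.act q (c.loc q) = .prim (.writeV l y) ∨ A.act q (c.loc q) = .prim (.casV l x y))

theorem Hit.of_frame {c d : Config n V VL ML M L} {q : Fin n} {l : VL} {x y : Option V}
    (h : Hit A c q l x y) (hf : Frame p c d) (hp : c.busy p = false) : Hit A d q l x y := by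
  have hq : q ≠ p := by
    rintro rfl
    simp [h.1] at hp
  obtain ⟨h1, h2⟩ := hf q hq
  simpa only [Hit, h1, h2] using h

theorem Step.hit {c c' : Config n V VL ML M L} {e : Event n V VL ML M} (h : Step A c e c')
    (he : EventOf p e) {l : VL} (hl : c'.vmem l ≠ c.vmem l) :
    Hit A c p l (c.vmem l) (c'.vmem l) := by
  classical
  cases h with
  | inv => exact absurd rfl hl
  | res => exact absurd rfl hl
  | prim q a hb ha =>
    cases he
    refine ⟨hb, ?_⟩
    rw [ha]
    cases a with
    | writeV k w =>
      by_cases hk : l = k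
      · subst hk; simp [primV]
      · exact absurd (by simp [primV, Function.update_of_ne hk]) hl
    | casV k old new =>
      by_cases hold : c.vmem k = old
      · by_cases hk : l = k
        · subst hk; simp [primV, hold]
        · exact absurd (by simp [primV, hold, Function.update_of_ne hk]) hl
      · exact absurd (by simp [primV, hold]) hl
    | _ => exact absurd rfl hl

theorem Hit.step {c : Config n V VL ML M L} {q : Fin n} {l : VL} {x y : Option V}
    (h : Hit A c q l x y) (hx : c.vmem l = x) [DecidableEq VL] :
    ∃ e c', Step A c e c' ∧ IsPrimOf q e ∧ c'.vmem = Function.update c.vmem l y ∧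
      c'.mmem = c.mmem ∧ c'.busy = c.busy ∧ ∀ q', q' ≠ q → c'.loc q' = c.loc q' := by
  obtain ⟨hb, h | h⟩ := h
  · refine ⟨_, _, .prim c q _ hb h, ⟨_, _, rfl⟩, ?_, rfl, rfl, fun q' hq => ?_⟩
    · simp only [primV]; congr!
    · simp [Function.update_of_ne hq]
  · refine ⟨_, _, .prim c q _ hb h, ⟨_, _, rfl⟩, ?_, rfl, rfl, fun q' hq => ?_⟩
    · simp only [primV, hx, if_true]; congr!
    · simp [Function.update_of_ne hq]

theorem Exec.exists_hit {c c' : Config n V VL ML M L} {σ : List (Event n V VL ML M)}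
    (h : Exec A c σ c') (hσ : ∀ e ∈ σ, EventOf p e) (hc : Reachable A c) {l : VL} {a : V}
    (hl : c.vmem l = some a) (hl' : c'.vmem l ≠ some a) :
    ∃ d y, Reachable A d ∧ Frame p c d ∧ Hit A d p l (some a) y ∧ y ≠ some a := by
  induction h with
  | nil => exact absurd hl hl'
  | @cons c c' c'' e σ s h ih =>
    have he := hσ e (by simp)
    by_cases hch : c'.vmem l = some a
    · obtain ⟨d, y, h1, h2, h3⟩ := ih (fun e he => hσ e (List.mem_cons_of_mem _ he))
        (hc.exec (.single s)) hch hl'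
      exact ⟨d, y, h1, (s.frame he).trans h2, h3⟩
    · exact ⟨c, _, hc, .refl c, hl ▸ s.hit he (by rwa [hl]), hch⟩

/-- Stop `p` before the first step that makes the content of `l` something other than `a` and ⊥. The
value `w` written then need not be `b`. -/
theorem Exec.exists_hit_value {c c' : Config n V VL ML M L} {σ : List (Event n V VL ML M)}
    (h : Exec A c σ c') (hσ : ∀ e ∈ σ, EventOf p e) (hc : Reachable A c) {l : VL} {a b : V}
    (hl : c.vmem l = some a ∨ c.vmem l = none) (hl' : c'.vmem l = some b) (hab : b ≠ a) :
    ∃ d w, Reachable A d ∧ Frame p c d ∧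
      ((w ≠ a ∧ Hit A d p l (some a) (some w)) ∨ Hit A d p l none (some w)) := by
  induction h with
  | nil => simp_all
  | @cons c c' c'' e σ s h ih =>
    have he := hσ e (by simp)
    by_cases hch : c'.vmem l = some a ∨ c'.vmem l = none
    · obtain ⟨d, w, h1, h2, h3⟩ := ih (fun e he => hσ e (List.mem_cons_of_mem _ he))
        (hc.exec (.single s)) hch hl'
      exact ⟨d, w, h1, (s.frame he).trans h2, h3⟩
    · push Not at hch
      obtain ⟨w, hw⟩ := Option.ne_none_iff_exists'.1 hch.2
      have hne : c'.vmem l ≠ c.vmem l := by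
        rcases hl with h | h <;> rw [h]
        · exact hch.1
        · exact hch.2
      have := s.hit he hne
      rw [hw] at this
      refine ⟨c, w, hc, .refl c, ?_⟩
      rcases hl with h | h <;> rw [h] at this
      · refine .inl ⟨?_, this⟩
        rintro rfl
        exact hch.1 hw
      · exact .inr this

/-- Some poised processes can turn the content `a` of `l` into `w`. -/
def Killer (A : Implementation n V VL ML M L) (c : Config n V VL ML M L) (l : VL) (a w : V) :
    Prop :=
  (∃ q, Hit A c q l (some a) (some w)) ∨
    ∃ q q', Hit A c q l (some a) none ∧ Hit A c q' l none (some w)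

theorem Killer.of_frame {c d : Config n V VL ML M L} {l : VL} {a w : V}
    (h : Killer A c l a w) (hf : Frame p c d) (hp : c.busy p = false) : Killer A d l a w := by
  rcases h with ⟨q, h⟩ | ⟨q, q', h, h'⟩
  · exact .inl ⟨q, h.of_frame hf hp⟩
  · exact .inr ⟨q, q', h.of_frame hf hp, h'.of_frame hf hp⟩

theorem Killer.exec [DecidableEq VL] {c : Config n V VL ML M L} {l : VL} {a w : V}
    (h : Killer A c l a w) (hl : c.vmem l = some a) (hp : c.busy p = false) :
    ∃ σ c', Exec A c σ c' ∧ (∀ e ∈ σ, ∃ q, IsPrimOf q e) ∧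
      Agree p { c with vmem := Function.update c.vmem l (some w) } c' := by
  have hne : ∀ q x y, Hit A c q l x y → p ≠ q := by
    rintro q x y h rfl
    simp [h.1] at hp
  rcases h with ⟨q, h⟩ | ⟨q, q', h, h'⟩
  · obtain ⟨e, c', h1, h2, h3, h4, h5, h6⟩ := h.step hl
    exact ⟨[e], c', .single h1, by simpa using ⟨q, h2⟩, h3.symm, h4.symm, (h6 p (hne _ _ _ h)).symm,
      by rw [h5]⟩
  · obtain ⟨e, c', h1, h2, h3, h4, h5, h6⟩ := h.step hl
    -- One process cannot be poised to store both ⊥ and a value.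
    have hqq : q' ≠ q := by
      rintro rfl
      obtain ⟨-, h | h⟩ := h <;> obtain ⟨-, h' | h'⟩ := h' <;> rw [h] at h' <;> simp at h'
    have h'' : Hit A c' q' l none (some w) := by simpa only [Hit, h5, h6 q' hqq] using h'
    obtain ⟨e', c'', g1, g2, g3, g4, g5, g6⟩ := h''.step (by simp [h3])
    refine ⟨[e, e'], c'', .cons h1 (.single g1), ?_, ?_, ?_, ?_, ?_⟩
    · intro x hx
      simp only [List.mem_cons, List.not_mem_nil, or_false] at hx
      rcases hx with rfl | rfl
      exacts [⟨q, h2⟩, ⟨q', g2⟩]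
    · simp [g3, h3]
    · simp [g4, h4]
    · rw [g6 p (hne _ _ _ h'), h6 p (hne _ _ _ h)]
    · rw [g5, h5]

/-- At most `k` processes are executing operations. At each `l ∈ D`, some of them can turn `α l`
into `ω l`, and at each `l ∈ U` one of them can turn `⊥` into `ω l`. -/
structure Covered (A : Implementation n V VL ML M L) (c : Config n V VL ML M L) (k : ℕ)
    (D U : Finset VL) (α ω : VL → V) : Prop where
  reachable : Reachable A c
  busy : (Finset.univ.filter fun q => c.busy q = true).card ≤ k
  disjoint : Disjoint D U
  inj : Set.InjOn α D
  done : ∀ l ∈ D, ω l ≠ α l ∧ Killer A c l (α l) (ω l)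
  undone : ∀ l ∈ U, ∃ q, Hit A c q l none (some (ω l))

variable {c : Config n V VL ML M L} {k : ℕ} {D U : Finset VL} {α ω : VL → V}

theorem Covered.exists_idle (h : Covered A c k D U α ω) (hk : k < n) : ∃ p, c.busy p = false := by
  by_contra hcon
  push Not at hcon
  have := h.busy
  rw [Finset.filter_true_of_mem fun q _ => by simpa using hcon q] at this
  simp at this
  omega

/-- Poised processes are busy, hence different from the idle `p`, and they do not move while `p`
runs; at most `p` itself becomes busy. -/
theorem Covered.of_frame {d : Config n V VL ML M L} (h : Covered A c k D U α ω)
    (hf : Frame p c d) (hp : c.busy p = false) (hd : Reachable A d) :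
    Covered A d (k + 1) D U α ω where
  reachable := hd
  busy := by
    classical
    refine (Finset.card_le_card (t := insert p (Finset.univ.filter fun q => c.busy q = true))
      fun q hq => ?_).trans ((Finset.card_insert_le _ _).trans (Nat.succ_le_succ h.busy))
    by_cases hqp : q = p
    · simp [hqp]
    · simpa [hqp, (hf q hqp).2] using hq
  disjoint := h.disjoint
  inj := h.inj
  done l hl := ⟨(h.done l hl).1, (h.done l hl).2.of_frame hf hp⟩
  undone l hl := by
    obtain ⟨q, hq⟩ := h.undone l hl
    exact ⟨q, hq.of_frame hf hp⟩

theorem Covered.insert_done [DecidableEq VL] (h : Covered A c k D U α ω) {l : VL} (hD : l ∉ D)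
    (hU : l ∉ U) {a w : V} (ha : ∀ l' ∈ D, α l' ≠ a) (hw : w ≠ a) (hk : Killer A c l a w) :
    Covered A c k (insert l D) U (Function.update α l a) (Function.update ω l w) where
  reachable := h.reachable
  busy := h.busy
  disjoint := Finset.disjoint_insert_left.2 ⟨hU, h.disjoint⟩
  inj := by
    have hu : ∀ l' ∈ D, Function.update α l a l' = α l' := fun l' hl' =>
      Function.update_of_ne (by rintro rfl; exact hD hl') _ _
    intro x hx y hy hxy
    rw [Finset.mem_coe, Finset.mem_insert] at hx hy
    rcases hx with rfl | hx <;> rcases hy with rfl | hy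
    · rfl
    · rw [hu y hy, Function.update_self] at hxy
      exact absurd hxy.symm (ha y hy)
    · rw [hu x hx, Function.update_self] at hxy
      exact absurd hxy (ha x hx)
    · rw [hu x hx, hu y hy] at hxy
      exact h.inj hx hy hxy
  done l' hl' := by
    by_cases hll : l' = l
    · subst hll
      simpa using ⟨hw, hk⟩
    · simpa [hll] using h.done l' (by simpa [hll] using hl')
  undone l' hl' := by
    have hll : l' ≠ l := by rintro rfl; exact hU hl'
    simpa [hll] using h.undone l' hl'

theorem Covered.erase_undone [DecidableEq VL] (h : Covered A c k D U α ω) (l : VL) :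
    Covered A c k D (U.erase l) α ω where
  reachable := h.reachable
  busy := h.busy
  disjoint := h.disjoint.mono_right (Finset.erase_subset _ _)
  inj := h.inj
  done := h.done
  undone l' hl' := h.undone l' (Finset.mem_of_mem_erase hl')

theorem Covered.insert_undone [DecidableEq VL] (h : Covered A c k D U α ω) {l : VL} (hD : l ∉ D)
    {w : V} {q : Fin n} (hq : Hit A c q l none (some w)) :
    Covered A c k D (insert l U) α (Function.update ω l w) where
  reachable := h.reachable
  busy := h.busy
  disjoint := Finset.disjoint_insert_right.2 ⟨hD, h.disjoint⟩
  inj := h.inj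
  done l' hl' := by
    have hll : l' ≠ l := by rintro rfl; exact hD hl'
    simpa [hll] using h.done l' hl'
  undone l' hl' := by
    by_cases hll : l' = l
    · subst hll
      exact ⟨q, by simpa using hq⟩
    · simpa [hll] using h.undone l' (by simpa [hll] using hl')

variable [Fintype VL]

/-- When a process alone fills the queue, empties it and fills it again, most locations change
from one value to another; the process can be stopped before it makes such a change. -/
theorem exists_stops (hA : ObstructionFree A) (hL : Linearizable C A) (hN : NonCreative A)
    {c : Config n V VL ML M L} (hc : Reachable A c) (hp : c.busy p = false) (T : Finset V)
    (hT : ((T.card + C : ℕ) : ℕ∞) ≤ ENat.card V) (hV : ((C + C : ℕ) : ℕ∞) ≤ ENat.card V) :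
    ∃ G : Finset VL, 2 * C ≤ Fintype.card VL + G.card ∧ ∀ l ∈ G, ∃ a, a ∉ T ∧
      (∃ d y, Reachable A d ∧ Frame p c d ∧ Hit A d p l (some a) y ∧ y ≠ some a) ∧
      ∃ d w, Reachable A d ∧ Frame p c d ∧
        ((w ≠ a ∧ Hit A d p l (some a) (some w)) ∨ Hit A d p l none (some w)) := by
  classical
  obtain ⟨a, ha, haT⟩ := exists_fresh hT
  obtain ⟨b, hb, hba⟩ := exists_fresh (T := Finset.univ.image a) (k := C)
    (by rwa [Finset.card_image_of_injective _ ha, Finset.card_univ, Fintype.card_fin])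
  obtain ⟨s, c₀, h0, st0⟩ := exists_stable hA hL hc hp
  obtain ⟨c₁, h1, st1⟩ := st0.enq hA (e := List.ofFn a) (by simp)
  obtain ⟨c₂, h2, st2⟩ := st1.deq hA
  obtain ⟨c₃, h3, st3⟩ := st2.enq hA (e := List.ofFn b) (by simp)
  rw [List.nil_append] at st1 st3
  have hcard : ∀ (f : Fin C → V) (d : Config n V VL ML M L), Function.Injective f →
      Stable A C p d (List.ofFn f) →
      C ≤ (Finset.univ.filter fun l => ∃ j, d.vmem l = some (f j)).card := by
    intro f d hf st
    have : ∀ j, ∃ l, d.vmem l = some (f j) := fun j => st.mem hA hN (by simp)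
    choose g hg using this
    have := Finset.card_le_card_of_injOn (s := (Finset.univ : Finset (Fin C)))
      (t := Finset.univ.filter fun l => ∃ j, d.vmem l = some (f j)) g
      (fun j _ => by simpa using ⟨j, hg j⟩) (fun i _ j _ hij => by
        have h1 := hg i
        rw [hij, hg j] at h1
        exact (hf (Option.some.inj h1)).symm)
    simpa using this
  have k1 := hcard a c₁ ha st1
  have k3 := hcard b c₃ hb st3
  -- At least `C` locations store values of `a` after the first filling and at least `C` store
  -- values of `b` after the second, so the two sets share at least 2C - m locations.
  refine ⟨(Finset.univ.filter fun l => ∃ j, c₁.vmem l = some (a j)) ∩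
    Finset.univ.filter fun l => ∃ j, c₃.vmem l = some (b j), ?_, ?_⟩
  · have h4 := Finset.card_union_add_card_inter
      (Finset.univ.filter fun l => ∃ j, c₁.vmem l = some (a j))
      (Finset.univ.filter fun l => ∃ j, c₃.vmem l = some (b j))
    have h5 := Finset.card_le_univ ((Finset.univ.filter fun l => ∃ j, c₁.vmem l = some (a j)) ∪
      Finset.univ.filter fun l => ∃ j, c₃.vmem l = some (b j))
    omega
  · intro l hl
    simp only [Finset.mem_inter, Finset.mem_filter, Finset.mem_univ, true_and] at hl
    obtain ⟨⟨i, hi⟩, j, hj⟩ := hl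
    have hne : b j ≠ a i := fun h => hba j (by simp [h])
    obtain ⟨σ, e1, -, e2⟩ := (h2.append h3).exec
    have hf : Frame p c c₁ := (h0.append h1).frame
    refine ⟨a i, haT i, ?_, ?_⟩
    · obtain ⟨d, y, g1, g2, g3⟩ := e1.exists_hit e2 st1.1 hi (by rw [hj]; simpa using hne)
      exact ⟨d, y, g1, hf.trans g2, g3⟩
    · obtain ⟨d, w, g1, g2, g3⟩ := e1.exists_hit_value e2 st1.1 (.inl hi) hj hne
      exact ⟨d, w, g1, hf.trans g2, g3⟩

/-- There are at least 2C - m locations before whose change a process can be stopped, and fewer are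
covered; a new one goes to `D` or to `U`, depending on whether the stopped step replaces `a` or ⊥.
-/
theorem Covered.grow (h : Covered A c k D U α ω) (hA : ObstructionFree A) (hL : Linearizable C A)
    (hN : NonCreative A) (hk : k < n)
    (hV : ((2 * Fintype.card VL + 2 * C : ℕ) : ℕ∞) ≤ ENat.card V)
    (hcard : Fintype.card VL + D.card + U.card < 2 * C) :
    ∃ c' D' U' α' ω', Covered A c' (k + 1) D' U' α' ω' ∧
      D'.card + U'.card = D.card + U.card + 1 := by
  classical
  obtain ⟨p, hp⟩ := h.exists_idle hk
  have hDc : (D.image α).card ≤ Fintype.card VL := Finset.card_image_le.trans D.card_le_univ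
  obtain ⟨G, hG, hpoised⟩ := exists_stops hA hL hN h.reachable hp (D.image α)
    (le_trans (by exact_mod_cast by omega) hV) (le_trans (by exact_mod_cast by omega) hV)
  obtain ⟨l, hl, hl'⟩ : ∃ l ∈ G, l ∉ D ∪ U := by
    by_contra hcon
    push Not at hcon
    have h1 := Finset.card_le_card (show G ⊆ D ∪ U from hcon)
    have h2 := Finset.card_union_le D U
    omega
  rw [Finset.mem_union, not_or] at hl'
  obtain ⟨a, ha, -, d, w, hd, hf, hw⟩ := hpoised l hl
  have hcov := h.of_frame hf hp hd
  rcases hw with ⟨hw, hh⟩ | hh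
  · refine ⟨d, _, _, _, _, hcov.insert_done hl'.1 hl'.2 (fun l' h' he => ha ?_) hw
      (.inl ⟨p, hh⟩), ?_⟩
    · rw [← he]; exact Finset.mem_image_of_mem _ h'
    · rw [Finset.card_insert_of_notMem hl'.1]; omega
  · refine ⟨d, _, _, _, _, hcov.insert_undone hl'.1 hh, ?_⟩
    rw [Finset.card_insert_of_notMem hl'.2]; omega

/-- If |U| + (2C - m) > m, some `l ∈ U` is among the locations given by `exists_stops`. Stop a
process before `a` leaves `l`: either it writes another value at once, or it writes ⊥ and is paired
with the process already poised at `l`. -/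
theorem Covered.complete (h : Covered A c k D U α ω) (hA : ObstructionFree A)
    (hL : Linearizable C A) (hN : NonCreative A) (hk : k < n)
    (hV : ((2 * Fintype.card VL + 2 * C : ℕ) : ℕ∞) ≤ ENat.card V)
    (hcard : 2 * Fintype.card VL < 2 * C + U.card) :
    ∃ c' D' U' α' ω', Covered A c' (k + 1) D' U' α' ω' ∧
      D'.card = D.card + 1 ∧ U'.card + 1 = U.card := by
  classical
  obtain ⟨p, hp⟩ := h.exists_idle hk
  have hDc : (D.image α).card ≤ Fintype.card VL := Finset.card_image_le.trans D.card_le_univ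
  have hUc : (U.image ω).card ≤ Fintype.card VL := Finset.card_image_le.trans U.card_le_univ
  have hDU := Finset.card_union_le (D.image α) (U.image ω)
  -- Avoiding the values of `α` keeps `α` injective; avoiding those of `ω` on `U` ensures `ω l ≠ a`
  -- for the pair.
  obtain ⟨G, hG, hpoised⟩ := exists_stops hA hL hN h.reachable hp (D.image α ∪ U.image ω)
    (le_trans (by exact_mod_cast by omega) hV) (le_trans (by exact_mod_cast by omega) hV)
  obtain ⟨l, hlG, hlU⟩ : ∃ l, l ∈ G ∧ l ∈ U := by
    by_contra hcon
    push Not at hcon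
    have h1 := Finset.card_union_of_disjoint (Finset.disjoint_left.2 hcon)
    have h2 := Finset.card_le_univ (G ∪ U)
    omega
  have hlD : l ∉ D := Finset.disjoint_right.1 h.disjoint hlU
  obtain ⟨a, ha, ⟨d, y, hd, hf, hh, hy⟩, -⟩ := hpoised l hlG
  rw [Finset.mem_union, not_or] at ha
  have hcov := h.of_frame hf hp hd
  have hα : ∀ l' ∈ D, α l' ≠ a := fun l' h' he => ha.1 (he ▸ Finset.mem_image_of_mem _ h')
  have hcE := Finset.card_erase_add_one hlU
  have hcI := Finset.card_insert_of_notMem hlD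
  cases y with
  | some w =>
    exact ⟨d, _, _, _, _, (hcov.erase_undone l).insert_done hlD (by simp) hα
      (fun h => hy (by rw [h])) (.inl ⟨p, hh⟩), hcI, hcE⟩
  | none =>
    obtain ⟨q, hq⟩ := hcov.undone l hlU
    exact ⟨d, _, _, _, _, (hcov.erase_undone l).insert_done hlD (by simp) hα
      (fun h => ha.2 (h ▸ Finset.mem_image_of_mem _ hlU)) (.inr ⟨p, q, hh, hq⟩), hcI, hcE⟩

theorem exists_covered (hA : ObstructionFree A) (hL : Linearizable C A) (hN : NonCreative A)
    (hV : ((2 * Fintype.card VL + 2 * C : ℕ) : ℕ∞) ≤ ENat.card V) {N : ℕ} (hn : N ≤ n)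
    (hN' : Fintype.card VL + N ≤ 2 * C) (v : V) :
    ∃ (c : Config n V VL ML M L) (D U : Finset VL) (α ω : VL → V),
      Covered A c N D U α ω ∧ D.card + U.card = N := by
  induction N with
  | zero =>
    refine ⟨A.init, ∅, ∅, fun _ => v, fun _ => v, ⟨⟨[], .nil _⟩, ?_, ?_, ?_, ?_, ?_⟩, ?_⟩ <;>
      simp [Implementation.init]
  | succ N ih =>
    obtain ⟨c, D, U, α, ω, h, hc⟩ := ih (by omega) (by omega)
    obtain ⟨c', D', U', α', ω', h', hc'⟩ := h.grow hA hL hN (by omega) hV (by omega)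
    exact ⟨c', D', U', α', ω', h', by omega⟩

/-- Every application of `Covered.complete` moves one location from `U` to `D` for one more busy
process, until the pigeonhole argument fails. -/
theorem Covered.exists_done (h : Covered A c k D U α ω) (hA : ObstructionFree A)
    (hL : Linearizable C A) (hN : NonCreative A)
    (hV : ((2 * Fintype.card VL + 2 * C : ℕ) : ℕ∞) ≤ ENat.card V) (hk : k + U.card ≤ n) :
    ∃ c' D' U' α' ω', Covered A c' (k + U.card) D' U' α' ω' ∧
      D'.card + U'.card = D.card + U.card ∧ U'.card ≤ 2 * (Fintype.card VL - C) := by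
  induction hu : U.card generalizing c k D U α ω with
  | zero =>
    exact ⟨c, D, U, α, ω, by simpa [hu] using h, by omega, by omega⟩
  | succ u ih =>
    by_cases hle : U.card ≤ 2 * (Fintype.card VL - C)
    · exact ⟨c, D, U, α, ω, { h with busy := h.busy.trans (by omega) }, by omega, hle⟩
    · obtain ⟨c', D', U', α', ω', h', h1, h2⟩ := h.complete hA hL hN (by omega) hV (by omega)
      obtain ⟨c'', D'', U'', α'', ω'', h'', h3, h4⟩ := ih h' (by omega) (by omega)
      exact ⟨c'', D'', U'', α'', ω'', { h'' with busy := h''.busy.trans (by omega) }, by omega, h4⟩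

end Covering

/-! ### The contradiction and the choice of constants -/

section LowerBound
variable {n : ℕ} {V VL ML M L : Type*} {A : Implementation n V VL ML M L} {p : Fin n} {C : ℕ}

theorem pair_sublist_ofFn {k : ℕ} (f : Fin k → V) {i j : Fin k} (h : i < j) :
    [f i, f j].Sublist (List.ofFn f) := by
  have : (List.ofFn f).Pairwise fun a b => [a, b].Sublist (List.ofFn f) :=
    List.pairwise_iff_forall_sublist.2 fun h => h
  have h1 := List.pairwise_iff_getElem.1 this i j (by simp) (by simp) h
  simpa using h1

theorem exists_pending_finset {τ : List (Event n V VL ML M)} {c : Config n V VL ML M L}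
    (hτ : Exec A A.init τ c) :
    ∃ T : Finset V, T.card ≤ n ∧ ∀ q v, Pending τ q (.enq v) → v ∈ T := by
  classical
  obtain ⟨T, h1, h2⟩ := exists_finset_of_option fun q : Fin n =>
    if h : ∃ v, Pending τ q (.enq v) then some h.choose else none
  refine ⟨T, by simpa using h1, fun q v hv => h2 q v ?_⟩
  have h : ∃ v, Pending τ q (.enq v) := ⟨v, hv⟩
  rw [dif_pos h]
  exact congrArg some (Op.enq.inj (h.choose_spec.unique hτ hv))

/-- The value `a`, the only copy of which has been turned into `w`, cannot come out of the queue
any more, and `w` comes out in its place. -/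
theorem not_killer (hA : ObstructionFree A) (hL : Linearizable C A)
    (hV : DequeueValueIndependent A) {τ : List (Event n V VL ML M)}
    {c₁ c₂ c₄ : Config n V VL ML M L} (hτ : Exec A A.init τ c₁)
    (h₁ : SeqRun A p c₁ [(.deq, .deqR none)] c₂) {e : Fin C → V} (he : Function.Injective e)
    (h₂ : SeqRun A p c₂ ((List.ofFn e).map fun v => (Op.enq v, Resp.enqR true)) c₄)
    (hst : Stable A C p c₄ (List.ofFn e)) {i j k : Fin C} (hi : (i : ℕ) = 0) (hij : i < j)
    (hjk : j < k) {l : VL} (hl : ∀ l', c₄.vmem l' = some (e j) ↔ l' = l) {w : V}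
    (hw : ∀ m, e m ≠ w) (hpi : ∀ q, ¬ Pending τ q (.enq (e i)))
    (hpk : ∀ q, ¬ Pending τ q (.enq (e k))) : ¬ Killer A c₄ l (e j) w := by
  classical
  intro hkill
  obtain ⟨c₅, h₃, st5⟩ := hst.deq hA
  obtain ⟨c₆, h₄, -⟩ := st5.op hA .deq
  obtain ⟨c₇, h₅⟩ := hV c₄ c₆ p (e j) w (List.ofFn e) hst.1 ⟨l, (hl l).2 rfl, fun l' h => (hl l').1 h⟩
    (h₃.append h₄) (List.count_eq_one_of_mem (List.nodup_ofFn.2 he) (by simp))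
  obtain ⟨σ, c₈, h₆, h₇, h₈⟩ := hkill.exec ((hl l).2 rfl) hst.2.1
  have hsub : substV (e j) w c₄.vmem = Function.update c₄.vmem l (some w) := by
    funext l'
    by_cases h : l' = l
    · simp [substV, h, (hl l).2 rfl]
    · simp [substV, h, (hl l').not.2 h]
  rw [hsub] at h₅
  -- The configuration in `h₅` with its altered memory need not be reachable, but `c₈` is, and `p`
  -- cannot tell them apart.
  obtain ⟨c₉, h₉⟩ := h₅.transfer h₈
  obtain ⟨σ₁, x1, b1, -⟩ := (h₁.append h₂).exec
  obtain ⟨σ₂, x2, b2, -⟩ := h₉.exec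
  have hblocks := b1.append ((Blocks.of_prims (p := p) h₇).append b2)
  have hexec := hτ.append (x1.append (h₆.append x2))
  obtain ⟨u, hu, hown, -, hpend⟩ := LinearizableTrace.own_ops hτ
    (s := ((List.ofFn e).map fun v => (Op.enq v, Resp.enqR true)) ++
      (List.ofFn e).map fun v => (Op.deq, Resp.deqR (some (if v = e j then w else v))))
    hblocks (hL _ _ hexec)
  have hf : (List.ofFn e).map (fun v => ((Op.deq : Op V),
      Resp.deqR (some (if v = e j then w else v)))) =
      ((List.ofFn e).map fun v => if v = e j then w else v).map
        fun v => (Op.deq, Resp.deqR (some v)) := by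
    rw [List.map_map]
    rfl
  rw [hf] at hown
  have hik := hij.trans hjk
  refine legal_clash (x := e i) (z := e k) (w := w) hu hown (by simp) (List.nodup_ofFn.2 he) ?_ ?_
    ?_ ?_ (fun q r h => hpi q (hpend q _ r h)) fun q r h => hpk q (hpend q _ r h)
  · rw [List.head?_eq_getElem?, ← hi]
    simp
  · refine List.mem_map.2 ⟨e i, by simp, if_neg ?_⟩
    exact fun h => hij.ne (he h)
  · have := (pair_sublist_ofFn e hjk).map fun v => if v = e j then w else v
    have hne : e k ≠ e j := fun h => hjk.ne' (he h)
    simpa [hne] using this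
  · simpa using hw

variable [Fintype VL]

/-- If all the values of `e` are stored, most locations are the only ones to store an inner
value of `e`. -/
theorem le_card_unique [DecidableEq VL] {vm : VL → Option V} {e : Fin C → V}
    (he : Function.Injective e) (hvm : ∀ j, ∃ l, vm l = some (e j)) (j₀ j₁ : Fin C) :
    ∃ H : Finset VL, 2 * C ≤ Fintype.card VL + H.card + 2 ∧ ∀ l ∈ H, ∃ j, j ≠ j₀ ∧ j ≠ j₁ ∧
      vm l = some (e j) ∧ ∀ l', vm l' = some (e j) → l' = l := by
  classical
  choose f hf using hvm
  have hval : ∀ {l i j}, vm l = some (e i) → vm l = some (e j) → i = j := fun h h' =>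
    he (Option.some.inj (h.symm.trans h'))
  have hfinj : Function.Injective f := fun i j h => hval (hf i) (h ▸ hf j)
  -- The indices of values stored at least twice. Each costs an extra location, so C + |N| ≤ m.
  let N : Finset (Fin C) := Finset.univ.filter fun j => ∃ l, l ≠ f j ∧ vm l = some (e j)
  have hN : ∀ j ∈ N, ∃ l, l ≠ f j ∧ vm l = some (e j) := fun j hj => (Finset.mem_filter.1 hj).2
  have : Nonempty VL := ⟨f j₀⟩
  choose! g hg hg' using hN
  have hginj : Set.InjOn g N := fun i hi j hj h => hval (hg' i hi) (h ▸ hg' j hj)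
  have hdisj : Disjoint (Finset.univ.image f) (N.image g) := by
    rw [Finset.disjoint_left]
    intro l hl hl'
    obtain ⟨i, -, rfl⟩ := Finset.mem_image.1 hl
    obtain ⟨j, hj, h⟩ := Finset.mem_image.1 hl'
    have hij : i = j := hval (hf i) (h ▸ hg' j hj)
    subst hij
    exact hg i hj h
  have h1 := Finset.card_union_of_disjoint hdisj
  rw [Finset.card_image_of_injective _ hfinj, Finset.card_image_of_injOn hginj, Finset.card_univ,
    Fintype.card_fin] at h1
  have h2 := Finset.card_le_univ (Finset.univ.image f ∪ N.image g)
  let J : Finset (Fin C) := (Finset.univ \ N) \ {j₀, j₁}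
  have h3 : C ≤ J.card + N.card + 2 := by
    have h4 := Finset.le_card_sdiff {j₀, j₁} (Finset.univ \ N)
    have h5 := Finset.le_card_sdiff N (Finset.univ : Finset (Fin C))
    have h6 : ({j₀, j₁} : Finset (Fin C)).card ≤ 2 := Finset.card_le_two
    rw [Finset.card_univ, Fintype.card_fin] at h5
    show C ≤ ((Finset.univ \ N) \ {j₀, j₁}).card + N.card + 2
    omega
  refine ⟨J.image f, ?_, ?_⟩
  · rw [Finset.card_image_of_injective _ hfinj]
    omega
  · intro l hl
    obtain ⟨j, hj, rfl⟩ := Finset.mem_image.1 hl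
    simp only [J, N, Finset.mem_sdiff, Finset.mem_univ, Finset.mem_filter, true_and,
      Finset.mem_insert, Finset.mem_singleton, not_or, not_exists, not_and] at hj
    refine ⟨j, hj.2.1, hj.2.2, hf j, fun l' hl' => ?_⟩
    by_contra hne
    exact hj.1 l' hne hl'

/-- A location is wanted whose poised overwriting destroys an inner element of the full queue. It
must hold the only copy of that element, as dequeue-value-independence demands, and `α l` must be
absent before the filling, as enqueue-value-independence demands. -/
theorem Covered.false {c : Config n V VL ML M L} {k s : ℕ} {D U : Finset VL} {α ω : VL → V}
    (h : Covered A c k D U α ω) (hA : ObstructionFree A)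
    (hL : Linearizable C A) (hV : ValueIndependent A) (hk : k < n) (hC : 3 ≤ C)
    (hs : Fintype.card VL ≤ C + s) (hD : 3 * s + 3 ≤ D.card)
    (hcard : ((3 * Fintype.card VL + n + C : ℕ) : ℕ∞) ≤ ENat.card V) : False := by
  classical
  obtain ⟨hN, hE, hQ⟩ := hV
  obtain ⟨p, hp⟩ := h.exists_idle hk
  have hDc : (D.image α).card = D.card := Finset.card_image_of_injOn h.inj
  have hDu := D.card_le_univ
  obtain ⟨s₀, c₀, r₀, st₀⟩ := exists_stable hA hL h.reachable hp
  -- This first filling serves to crowd out old values: `f` takes `C` locations, so at most m - C of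
  -- the values `α l` survive, and lost ones do not return.
  obtain ⟨f, hf, hfT⟩ := exists_fresh (T := D.image α) (k := C)
    (le_trans (by exact_mod_cast by omega) hcard)
  obtain ⟨d, rd, std⟩ := st₀.enq hA (e := List.ofFn f) (by simp)
  rw [List.nil_append] at std
  obtain ⟨c₁, r₁, st₁⟩ := std.deq hA
  obtain ⟨c₂, r₂, st₂⟩ := st₁.op hA .deq
  change SeqRun A p c₁ [(.deq, .deqR none)] c₂ at r₂
  change Stable A C p c₂ [] at st₂
  -- few of the values `α l` are still in the memory
  let B : Finset VL := D.filter fun l => ∃ l', c₂.vmem l' = some (α l)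
  have hB : B.card + C ≤ Fintype.card VL := by
    have hBD : B ⊆ D := Finset.filter_subset _ _
    have hdisj : Disjoint (B.image α) (Finset.univ.image f) := by
      rw [Finset.disjoint_right]
      intro v hv hv'
      obtain ⟨i, -, rfl⟩ := Finset.mem_image.1 hv
      exact hfT i (Finset.image_subset_image hBD hv')
    have h1 := card_le_of_mem (vm := d.vmem) (X := B.image α ∪ Finset.univ.image f) (by
      intro v hv
      rcases Finset.mem_union.1 hv with hv | hv
      · obtain ⟨l, hl, rfl⟩ := Finset.mem_image.1 hv
        obtain ⟨-, l', hl'⟩ := Finset.mem_filter.1 hl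
        by_contra hcon
        push Not at hcon
        exact ((r₁.append r₂).absent hN std.1 hcon (by simp)).1 l' hl'
      · obtain ⟨i, -, rfl⟩ := Finset.mem_image.1 hv
        exact std.mem hA hN (by simp))
    rwa [Finset.card_union_of_disjoint hdisj, Finset.card_image_of_injOn (h.inj.mono hBD),
      Finset.card_image_of_injective _ hf, Finset.card_univ, Fintype.card_fin] at h1
  -- fill the queue with fresh values
  obtain ⟨τ, hτ⟩ := st₁.1
  obtain ⟨T₁, hT₁, hT₁'⟩ := exists_pending_finset hτ
  obtain ⟨T₂, hT₂, hT₂'⟩ := exists_finset_of_option c₂.vmem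
  have hT : (T₁ ∪ T₂ ∪ D.image α ∪ D.image ω).card ≤ 3 * Fintype.card VL + n := by
    have h1 := Finset.card_union_le (T₁ ∪ T₂ ∪ D.image α) (D.image ω)
    have h2 := Finset.card_union_le (T₁ ∪ T₂) (D.image α)
    have h3 := Finset.card_union_le T₁ T₂
    have h4 : (D.image ω).card ≤ D.card := Finset.card_image_le
    omega
  -- `T₁` keeps pending enqueues from inserting the first or last element, and `T₂` is the current
  -- content of the memory.
  obtain ⟨e, he, heT⟩ := exists_fresh (T := T₁ ∪ T₂ ∪ D.image α ∪ D.image ω) (k := C)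
    (le_trans (by exact_mod_cast by omega) hcard)
  simp only [Finset.mem_union, not_or] at heT
  obtain ⟨c₃, r₃, st₃⟩ := st₂.enq hA (e := List.ofFn e) (by simp)
  rw [List.nil_append] at st₃
  let i₀ : Fin C := ⟨0, by omega⟩
  let i₁ : Fin C := ⟨C - 1, by omega⟩
  obtain ⟨H, hH, hH'⟩ := le_card_unique (vm := c₃.vmem) he
    (fun j => st₃.mem hA hN (by simp)) i₀ i₁
  -- With r = m - C ≤ s, |D \ B| ≥ 3s + 3 - r and |H| ≥ C - r - 2; their sum exceeds m = C + r.
  obtain ⟨l, hlD, hlB, hlH⟩ : ∃ l ∈ D, l ∉ B ∧ l ∈ H := by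
    by_contra hcon
    push Not at hcon
    have h1 : Disjoint (D \ B) H := Finset.disjoint_left.2 fun l hl =>
      hcon l (Finset.mem_sdiff.1 hl).1 (Finset.mem_sdiff.1 hl).2
    have h2 := Finset.card_union_of_disjoint h1
    have h3 := Finset.card_le_univ (D \ B ∪ H)
    have h4 := Finset.le_card_sdiff B D
    omega
  obtain ⟨j, hj₀, hj₁, hjl, hju⟩ := hH' l hlH
  have hal : ∀ l', c₂.vmem l' ≠ some (α l) := fun l' hl' =>
    hlB (Finset.mem_filter.2 ⟨hlD, l', hl'⟩)
  have hea : ∀ i, e i ≠ α l := fun i hi =>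
    (heT i).1.2 (hi ▸ Finset.mem_image_of_mem _ hlD)
  have hew : ∀ i, e i ≠ ω l := fun i hi =>
    (heT i).2 (hi ▸ Finset.mem_image_of_mem _ hlD)
  -- the same with `α l` in place of the value stored at `l`
  obtain ⟨c₄, r₄, st₄⟩ := st₂.enq hA (e := List.ofFn (Function.update e j (α l))) (by simp)
  rw [List.nil_append] at st₄
  have hmem := (hE c₂ c₃ c₄ p C e j (α l) (fun _ => .enqR true) (fun _ => .enqR true) st₂.1 he hea
    hal (fun l' i hi => (heT i).1.1.2 (hT₂' l' _ hi)) (by rw [List.map_ofFn] at r₃; exact r₃)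
    (by rw [List.map_ofFn] at r₄; exact r₄)).1
  have hal₃ : ∀ l', c₃.vmem l' ≠ some (α l) := (r₃.absent hN st₂.1 hal (by
    intro r hr
    obtain ⟨v, hv, hv'⟩ := List.mem_map.1 hr
    simp only [Prod.mk.injEq, Op.enq.injEq] at hv'
    obtain ⟨i, rfl⟩ := List.mem_ofFn.1 hv
    exact hea i hv'.1)).1
  have hkill : Killer A c₄ l (α l) (ω l) :=
    (h.done l hlD).2.of_frame
      (r₀.append (rd.append (r₁.append (r₂.append r₄)))).frame hp
  have hself : Function.update e j (α l) j = α l := by simp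
  have hne : ∀ {i}, i ≠ j → Function.update e j (α l) i = e i := fun h =>
    Function.update_of_ne h _ _
  have hj0 : i₀ < j := lt_of_le_of_ne (Nat.zero_le _) hj₀.symm
  have hj1 : j < i₁ := lt_of_le_of_ne (Nat.le_sub_one_of_lt j.2) hj₁
  refine not_killer hA hL hQ hτ r₂ (e := Function.update e j (α l)) ?_ r₄ st₄ (i := i₀) (j := j)
    (k := i₁) (l := l) (w := ω l) rfl hj0 hj1 ?_ ?_ ?_ ?_ (by rwa [hself])
  · intro x y hxy
    by_cases hx : x = j <;> by_cases hy : y = j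
    · rw [hx, hy]
    · rw [hx, hself, hne hy] at hxy
      exact absurd hxy.symm (hea y)
    · rw [hy, hself, hne hx] at hxy
      exact absurd hxy (hea x)
    · rw [hne hx, hne hy] at hxy
      exact he hxy
  · intro l'
    rw [hself, hmem]
    simp only [substV]
    constructor
    · intro h'
      split at h'
      · exact hju l' (by assumption)
      · exact absurd h' (hal₃ l')
    · rintro rfl
      rw [if_pos hjl]
  · intro i
    by_cases hi : i = j
    · rw [hi, hself]
      exact (h.done l hlD).1.symm
    · rw [hne hi]
      exact hew i
  · intro q hq
    rw [hne hj0.ne] at hq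
    exact (heT i₀).1.1.1 (hT₁' q _ hq)
  · intro q hq
    rw [hne hj1.ne'] at hq
    exact (heT i₁).1.1.1 (hT₁' q _ hq)

theorem capacity_le_card (hA : ObstructionFree A) (hL : Linearizable C A)
    (hN : NonCreative A) (hn : 1 ≤ n) (hcard : (C : ℕ∞) ≤ ENat.card V) :
    C ≤ Fintype.card VL := by
  classical
  obtain ⟨f, hf, -⟩ := exists_fresh (T := (∅ : Finset V)) (k := C) (by simpa using hcard)
  obtain ⟨s, c, -, st⟩ := exists_stable hA hL (c := A.init) ⟨[], .nil _⟩ (p := ⟨0, hn⟩) rfl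
  obtain ⟨c', -, st'⟩ := st.enq hA (e := List.ofFn f) (by simp)
  have := card_le_of_mem (vm := c'.vmem) (X := Finset.univ.image f) (by
    intro v hv
    obtain ⟨i, -, rfl⟩ := Finset.mem_image.1 hv
    exact st'.mem hA hN (by simp))
  rwa [Finset.card_image_of_injective _ hf, Finset.card_univ, Fintype.card_fin] at this

/-- Start with 5s + 3 covered locations. At most 2s stay in `U`, so `D` gets the 3s + 3 that
`Covered.false` needs. At most 2(5s + 3) processes become busy, and one more must be idle: 10s + 7.
-/
theorem lt_card (hA : ObstructionFree A) (hL : Linearizable C A) (hV : ValueIndependent A)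
    {s : ℕ} (hs : 10 * s + 7 ≤ n) (hn : 2 * n < C)
    (hcard : ((10 * C : ℕ) : ℕ∞) ≤ ENat.card V) : C + s < Fintype.card VL := by
  by_contra hcon
  push Not at hcon
  have hle := capacity_le_card hA hL hV.1 (by omega) (le_trans (by exact_mod_cast by omega) hcard)
  have hV1 : ((2 * Fintype.card VL + 2 * C : ℕ) : ℕ∞) ≤ ENat.card V :=
    le_trans (by exact_mod_cast by omega) hcard
  obtain ⟨f, -, -⟩ := exists_fresh (T := (∅ : Finset V)) (k := C)
    (le_trans (by exact_mod_cast by simp; omega) hcard)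
  obtain ⟨c, D, U, α, ω, h, h1⟩ := exists_covered (A := A) hA hL hV.1 hV1 (N := 5 * s + 3)
    (by omega) (by omega) (f ⟨0, by omega⟩)
  obtain ⟨c', D', U', α', ω', h', h2, h3⟩ := h.exists_done hA hL hV.1 hV1 (by omega)
  exact h'.false hA hL hV (by omega) (by omega) hcon (by omega)
    (le_trans (by exact_mod_cast by omega) hcard)

end LowerBound
end BQueue

theorem theorem1 :
    ∃ (K n₀ : ℕ) (c : ℝ), 0 < c ∧
      ∀ (n C : ℕ) (V VL ML M L : Type*) [Fintype VL]
        (A : BQueue.Implementation n V VL ML M L),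
        1 ≤ n → (n : ℝ) < (C : ℝ) / 2 →
        ((K * n * C : ℕ) : ℕ∞) ≤ ENat.card V →
        BQueue.ObstructionFree A → BQueue.Linearizable C A → BQueue.ValueIndependent A →
        (C : ℤ) + ⌊((n : ℝ) - 32) / 40⌋ ≤ (Fintype.card VL : ℤ) ∧
        (n₀ ≤ n → (C : ℝ) + c * n ≤ (Fintype.card VL : ℝ)) := by
  -- (n - 32)/40 - 1 ≥ n/80 holds exactly for n ≥ 144.
  refine ⟨10, 144, 1 / 80, by norm_num, ?_⟩
  intro n C V VL ML M L _ A hn hnC hcard hA hL hV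
  have hnC' : 2 * n < C := by
    have : (2 * n : ℝ) < C := by linarith
    exact_mod_cast this
  have hcard' : ((10 * C : ℕ) : ℕ∞) ≤ ENat.card V := by
    refine le_trans ?_ hcard
    exact_mod_cast by nlinarith
  have hmain : (C : ℤ) + ⌊((n : ℝ) - 32) / 40⌋ ≤ (Fintype.card VL : ℤ) := by
    rcases le_or_gt ⌊((n : ℝ) - 32) / 40⌋ 0 with h | h
    · have := BQueue.capacity_le_card hA hL hV.1 hn
        (le_trans (by exact_mod_cast by omega) hcard')
      omega
    · obtain ⟨s, hs⟩ := Int.eq_ofNat_of_zero_le (Int.le_sub_one_of_lt h)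
      have h1 := Int.floor_le (((n : ℝ) - 32) / 40)
      have h2 : (⌊((n : ℝ) - 32) / 40⌋ : ℝ) = s + 1 := by
        have h3 : ⌊((n : ℝ) - 32) / 40⌋ = (s : ℤ) + 1 := by omega
        rw [h3]
        push_cast
        rfl
      have h4 : 10 * s + 7 ≤ n := by
        have h5 : (s : ℝ) ≥ 0 := s.cast_nonneg
        have : (10 * s + 7 : ℝ) ≤ n := by linarith
        exact_mod_cast this
      have := BQueue.lt_card hA hL hV h4 hnC' hcard'
      omega
  refine ⟨hmain, fun hn₀ => ?_⟩
  have h1 := Int.lt_floor_add_one (((n : ℝ) - 32) / 40)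
  have h2 : (C : ℝ) + ⌊((n : ℝ) - 32) / 40⌋ ≤ (Fintype.card VL : ℝ) := by exact_mod_cast hmain
  have h3 : (144 : ℝ) ≤ n := by exact_mod_cast hn₀
  linarith
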